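/- Let $\mathbb{E}^{1,3}$ be $\mathbb{R}^4$ with the Lorentzian scalar product $\langle x,y\rangle=-x_0y_0+x_1y_1+x_2y_2+x_3y_3$, and let $\mathbb{H}^3=\{x\in\mathbb{E}^{1,3} : \langle x,x\rangle=-1,\ x_0>0\}$ be hyperbolic three-space. Let $$\mathrm{U}\mathbb{H}^3=\{(x,v) : x\in\mathbb{H}^3,\ \langle v,v\rangle=1,\ \langle x,v\rangle=0\}=\mathrm{SL}_2\mathbb{C}/\mathrm{U}_1$$ be its unit tangent sphere bundle, and let $\mathrm{Geo}(\mathbb{H}^3)=\{x\wedge v : (x,v)\in\mathrm{U}\mathbb{H}^3\}\subset\Lambda^2\mathbb{E}^{1,3}$ be the space of oriented geodesics of $\mathbb{H}^3$, that is, the Grassmannian of oriented timelike planes in $\mathbb{E}^{1,3}$, which is the symmetric space $\mathrm{SL}_2\mathbb{C}/\mathrm{GL}_1\mathbb{C}$. Both spaces carry the $\mathrm{SL}_2\mathbb{C}$-invariant semi-Riemannian metrics induced by the scalar product $\frac12\operatorname{Re}\operatorname{tr}(XY)$ on $\mathfrak{sl}_2\mathbb{C}$. Explicitly, $\mathrm{U}\mathbb{H}^3$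 has the metric $\frac14\left(\langle dx,dx\rangle-\langle dv,dv\rangle-\langle dx,v\rangle^2\right)$, and $\mathrm{Geo}(\mathbb{H}^3)$ has $\frac14$ of the metric induced from the scalar product $\langle a\wedge b,c\wedge d\rangle=\langle a,c\rangle\langle b,d\rangle-\langle a,d\rangle\langle b,c\rangle$ on $\Lambda^2\mathbb{E}^{1,3}$. Let $M$ be a connected smooth surface, and let $f:M\to\mathbb{H}^3$ be a smooth immersion with smooth unit normal $n:M\to\mathbb{E}^{1,3}$ (so $\langle n,n\rangle=1$, $\langle f,n\rangle=0$, $\langle df,n\rangle=0$). Assume that the Gaussian curvature $K$ of the first fundamental form $\mathrm{I}=\langle df,df\rangle$ satisfies $K>-1$ everywhere. Then the second fundamental form $\mathrm{I\!I}=-\langle df,dn\rangle$ is definite, and $M$ is given the conformal structure determined by $\mathrm{I\!I}$. Then the following four statements are equivalent. 1. The Gaussian curvature $K$ is constant. 2. The Legendrian Gauss map $F=(f,n):M\to\mathrm{U}\mathbb{H}^3$ is harmonic. 3. The Lagrangian Gauss map $L=f\wedge n:M\to\mathrm{Geo}(\mathbb{H}^3)$ is harmonic. 4. The Klotz differential $Q\,dz^2=\langle\partial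 f,\partial f\rangle\,dz^2$ is holomorphic. Here $z=x+iy$ is a local conformal coordinate for $\mathrm{I\!I}$ and $\partial=\frac12\left(\frac{\partial}{\partial x}-i\frac{\partial}{\partial y}\right)$. Equivalently, the Klotz differential is the $(2,0)$-part of $\mathrm{I}$, and the condition is that it is annihilated by $\bar\partial$. Harmonicity is with respect to the conformal structure of $\mathrm{I\!I}$ on $M$ and the metrics above: a smooth map is harmonic if it is a critical point of the energy for all compactly supported smooth variations. -/

import Mathlib

open Set MeasureTheory
open scoped Manifold ContDiff Matrix

noncomputable section

namespace HypSurf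

/-! ### Minkowski four-space, hyperbolic three-space and its unit tangent bundle -/

/-- The vector space underlying Minkowski four-space, with coordinates `(x₀, x₁, x₂, x₃)`. -/
abbrev E13 : Type := Fin 4 → ℝ

/-- The Lorentzian scalar product `-x₀y₀ + x₁y₁ + x₂y₂ + x₃y₃`. -/
def mink (x y : E13) : ℝ := -(x 0 * y 0) + x 1 * y 1 + x 2 * y 2 + x 3 * y 3

/-- Hyperbolic three-space as the upper sheet of the hyperboloid. -/
def H3 : Set E13 := {x | mink x x = -1 ∧ 0 < x 0}

/-- The unit tangent sphere bundle of hyperbolic three-space. -/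
def UH3 : Set (E13 × E13) :=
  {b | b.1 ∈ H3 ∧ mink b.2 b.2 = 1 ∧ mink b.1 b.2 = 0}

/-- The semi-Riemannian metric of `UH3` at `b = (x, v)`, on tangent vectors
`w = (x', v')`: the `SL₂ℂ`-invariant metric of the naturally reductive space `SL₂ℂ / U₁` induced by
the scalar product `Re (tr (X Y)) / 2` of `sl₂ℂ`; see `unitMetric_eq_killing`. -/
def unitMetric (b w w' : E13 × E13) : ℝ :=
  (1 / 4) * (mink w.1 w'.1 - mink w.2 w'.2 - mink w.1 b.2 * mink w'.1 b.2)

/-- Bivectors of Minkowski four-space, as (skew-symmetric) arrays of Plücker coordinates. -/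
abbrev Bivector : Type := Fin 4 → Fin 4 → ℝ

/-- The bivector `x ∧ v`. -/
def wedge (x v : E13) : Bivector := fun i j => x i * v j - x j * v i

/-- The signs of the Lorentzian scalar product. -/
def sgn (i : Fin 4) : ℝ := if i = 0 then -1 else 1

/-- The scalar product of bivectors, for which
`⟨x ∧ v, y ∧ w⟩ = ⟨x, y⟩⟨v, w⟩ - ⟨x, w⟩⟨v, y⟩`. -/
def biForm (A B : Bivector) : ℝ :=
  (1 / 2) * ∑ i, ∑ j, sgn i * sgn j * A i j * B i j

/-- The space of oriented geodesics of `H3`, that is, the Grassmannian of oriented timelike planes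
of Minkowski four-space: the plane with oriented orthonormal basis `(x, v)` is the
bivector `x ∧ v`. -/
def Geo : Set Bivector := {A | ∃ b ∈ UH3, A = wedge b.1 b.2}

/-- The semi-Riemannian metric of `Geo`, which is the one of the symmetric space `SL₂ℂ / GL₁ℂ`
induced by the scalar product `Re (tr (X Y)) / 2` of `sl₂ℂ`; see `geoMetric_eq_killing`.
It does not depend on the base point, since it is the restriction of a constant
scalar product on bivectors. -/
def geoMetric (_ A B : Bivector) : ℝ := (1 / 4) * biForm A B

/-! ### Coordinate expressions -/

/-- The coordinate plane. -/
abbrev Plane : Type := EuclideanSpace ℝ (Fin 2)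

/-- The partial derivative `∂ᵢ φ` at `x`. -/
def pd {V : Type*} [NormedAddCommGroup V] [NormedSpace ℝ V] (i : Fin 2) (φ : Plane → V)
    (x : Plane) : V :=
  fderiv ℝ φ x (EuclideanSpace.single i 1)

/-- The matrix of the first fundamental form `⟨df, df⟩` in coordinates. -/
def firstForm (f : Plane → E13) (x : Plane) : Matrix (Fin 2) (Fin 2) ℝ :=
  Matrix.of fun i j => mink (pd i f x) (pd j f x)

/-- The matrix of the second fundamental form `-⟨df, dn⟩` in coordinates. -/
def secondForm (f n : Plane → E13) (x : Plane) : Matrix (Fin 2) (Fin 2) ℝ :=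
  Matrix.of fun i j => -mink (pd i f x) (pd j n x)

/-- The Christoffel symbol `Γᵏᵢⱼ` of the metric `g`. -/
def christoffel (g : Plane → Matrix (Fin 2) (Fin 2) ℝ) (k i j : Fin 2) (x : Plane) : ℝ :=
  (1 / 2) * ∑ l, (g x)⁻¹ k l *
    (pd i (fun y => g y j l) x + pd j (fun y => g y i l) x - pd l (fun y => g y i j) x)

/-- The component `Rˡₖᵢⱼ` of the Riemann tensor of `g`, with
`R(∂ᵢ, ∂ⱼ)∂ₖ = ∑ₗ Rˡₖᵢⱼ ∂ₗ` and `R(X, Y) = ∇_X ∇_Y - ∇_Y ∇_X - ∇_[X, Y]`. -/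
def riemann (g : Plane → Matrix (Fin 2) (Fin 2) ℝ) (l k i j : Fin 2) (x : Plane) : ℝ :=
  pd i (christoffel g l j k) x - pd j (christoffel g l i k) x
    + ∑ m, (christoffel g l i m x * christoffel g m j k x
          - christoffel g l j m x * christoffel g m i k x)

/-- The Gaussian curvature `g(R(∂₁, ∂₂)∂₂, ∂₁) / det g` of the two-dimensional metric `g`. -/
def curvature (g : Plane → Matrix (Fin 2) (Fin 2) ℝ) (x : Plane) : ℝ :=
  (∑ l, g x 0 l * riemann g l 1 0 1 x) / (g x).det

/-- The energy density, with respect to Lebesgue measure in coordinates, of a map `φ` from a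
surface with metric `h` (given by its matrix at `x`) to a space with metric `G`:
`(1/2) √(det h) ∑ hⁱʲ G(∂ᵢφ, ∂ⱼφ)`. It depends only on the conformal class of `h`. For
negative definite `h` it is minus the energy density for `-h`, so critical points are the same. -/
def energyDensity {V : Type*} [NormedAddCommGroup V] [NormedSpace ℝ V]
    (h : Matrix (Fin 2) (Fin 2) ℝ) (G : V → V → V → ℝ) (φ : Plane → V) (x : Plane) : ℝ :=
  (1 / 2) * (Real.sqrt h.det * ∑ i, ∑ j, h⁻¹ i j * G (φ x) (pd i φ x) (pd j φ x))

/-! ### Complex vector fields in coordinates -/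

/-- The derivative `Y φ = ∑ᵢ Yⁱ ∂ᵢφ` of a complex-valued function along a complex tangent vector. -/
def cderiv (Y : Fin 2 → ℂ) (φ : Plane → ℂ) (x : Plane) : ℂ := ∑ i, Y i * pd i φ x

/-- The complex bilinear extension of a real symmetric form. -/
def cform (b : Matrix (Fin 2) (Fin 2) ℝ) (Y Z : Fin 2 → ℂ) : ℂ := ∑ i, ∑ j, (b i j : ℂ) * Y i * Z j

/-- The complex conjugate of a complex tangent vector. -/
def conjv (Y : Fin 2 → ℂ) : Fin 2 → ℂ := fun i => (starRingEnd ℂ) (Y i)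

/-- The bracket `[Z, Y]` of complex vector fields. -/
def bracket (Z Y : Plane → Fin 2 → ℂ) (x : Plane) : Fin 2 → ℂ := fun k =>
  cderiv (Z x) (fun y => Y y k) x - cderiv (Y x) (fun y => Z y k) x

/-! ### Surfaces and their Gauss maps -/

section Surfaces

variable {M : Type*} [TopologicalSpace M] [ChartedSpace Plane M]

/-- `f` is a smooth immersion of `M` into hyperbolic three-space, and `n` is a smooth
unit normal field of `f`. -/
structure IsSurface (f n : M → E13) : Prop where
  smooth : ContMDiff (𝓡 2) 𝓘(ℝ, E13) ∞ f
  smooth_normal : ContMDiff (𝓡 2) 𝓘(ℝ, E13) ∞ n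
  mem : ∀ p, f p ∈ H3
  immersion : ∀ p, Function.Injective (mfderiv (𝓡 2) 𝓘(ℝ, E13) f p)
  unit : ∀ p, mink (n p) (n p) = 1
  tangent : ∀ p, mink (f p) (n p) = 0
  normal : ∀ p (v : TangentSpace (𝓡 2) p), mink (mfderiv (𝓡 2) 𝓘(ℝ, E13) f p v) (n p) = 0

/-- The Gaussian curvature of the surface `f` at `p`, that is, of its first fundamental form. -/
def gaussCurvature (f : M → E13) (p : M) : ℝ :=
  curvature (firstForm fun x => f ((chartAt Plane p).symm x)) (chartAt Plane p p)

/-- The second fundamental form, as the family of its matrices in local coordinates. -/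
def secondFormIn (f n : M → E13) (e : OpenPartialHomeomorph M Plane) :
    Plane → Matrix (Fin 2) (Fin 2) ℝ :=
  secondForm (fun x => f (e.symm x)) (fun x => n (e.symm x))

/-- Harmonic maps from the surface `M` with the conformal structure of `h` (given by its matrices
`h e` in the coordinates `e`) into `N ⊆ V` with the semi-Riemannian metric `G`: smooth
maps `φ` that are critical points of the energy for all smooth variations `Φ s` of `φ` through maps
into `N` that are supported in a compact subset `C` of a coordinate domain. -/
def IsHarmonic {V : Type*} [NormedAddCommGroup V] [NormedSpace ℝ V]
    (h : OpenPartialHomeomorph M Plane → Plane → Matrix (Fin 2) (Fin 2) ℝ)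
    (N : Set V) (G : V → V → V → ℝ) (φ : M → V) : Prop :=
  ContMDiff (𝓡 2) 𝓘(ℝ, V) ∞ φ ∧ (∀ p, φ p ∈ N) ∧
  ∀ e ∈ IsManifold.maximalAtlas (𝓡 2) ∞ M, ∀ C : Set Plane, IsCompact C → C ⊆ e.target →
    ∀ ε : ℝ, 0 < ε → ∀ Φ : ℝ → Plane → V,
      ContDiffOn ℝ ∞ (fun q : ℝ × Plane => Φ q.1 q.2) (Ioo (-ε) ε ×ˢ e.target) →
      (∀ s ∈ Ioo (-ε) ε, ∀ x ∈ e.target, Φ s x ∈ N) →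
      (∀ x ∈ e.target, Φ 0 x = φ (e.symm x)) →
      (∀ s ∈ Ioo (-ε) ε, ∀ x ∈ e.target \ C, Φ s x = φ (e.symm x)) →
      HasDerivAt (fun s => ∫ x in C, energyDensity (h e x) G (Φ s) x) 0 0

/-- The Legendrian Gauss map `(f, n)`, with values in `UH3`. -/
def legendrianGaussMap (f n : M → E13) (p : M) : E13 × E13 := (f p, n p)

/-- The Lagrangian Gauss map `f ∧ n`, with values in `Geo`. -/
def lagrangianGaussMap (f n : M → E13) (p : M) : Bivector := wedge (f p) (n p)

/-- Let `Y` be a nowhere vanishing complex vector field that is isotropic for the definite form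
`b` (that is, of type `(1, 0)` for the conformal structure of `b` with one of
the two orientations), and let `q` be the quadratic differential of type `(2, 0)` with
`q(Y, Y) = g(Y, Y)`. This is the value on `(conj Y, Y, Y)` of its Cauchy-Riemann derivative:
`(∂̄q)(conj Y, Y, Y) = (conj Y)(g(Y, Y)) - 2 g([conj Y, Y]', Y)`, where
`Z' = b(Z, conj Y) / b(Y, conj Y) • Y` is the component of type `(1, 0)` of `Z`. -/
def dbar (g b : Plane → Matrix (Fin 2) (Fin 2) ℝ) (Y : Plane → Fin 2 → ℂ) (x : Plane) : ℂ :=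
  cderiv (conjv (Y x)) (fun y => cform (g y) (Y y) (Y y)) x
    - 2 * cform (g x)
        ((cform (b x) (bracket (fun y => conjv (Y y)) Y x) (conjv (Y x))
          / cform (b x) (Y x) (conjv (Y x))) • Y x) (Y x)

/-- The Klotz differential, the part of type `(2, 0)` of the first fundamental form for the
conformal structure of the second fundamental form, is holomorphic: `∂̄` annihilates it. If
`z` is a conformal coordinate, then the field `Y = ∂/∂z` commutes with its
conjugate, and the equation for it says that `⟨∂f, ∂f⟩` is a holomorphic function of `z`
(`klotz_conformal`); the equations for the other fields follow from it. No
conformal coordinate is needed to state them. The fields of type `(1, 0)` for the opposite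
orientation are the conjugate ones, and give the conjugate equations. -/
def KlotzHolomorphic (f n : M → E13) : Prop :=
  ∀ e ∈ IsManifold.maximalAtlas (𝓡 2) ∞ M, ∀ U : Set Plane, IsOpen U → U ⊆ e.target →
    ∀ Y : Plane → Fin 2 → ℂ, ContDiffOn ℝ ∞ Y U →
      (∀ x ∈ U, Y x ≠ 0 ∧ cform (secondFormIn f n e x) (Y x) (Y x) = 0) →
      ∀ x ∈ U, dbar (firstForm fun y => f (e.symm y)) (secondFormIn f n e) Y x = 0

end Surfaces

/-! ### Consistency of the definitions -/

/-- The field `∂ = (∂₁ - i ∂₂) / 2`. -/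
def dz : Fin 2 → ℂ := ![1 / 2, -Complex.I / 2]

/-- On a coordinate domain on which the second fundamental form is conformal, the
Cauchy-Riemann derivative of the Klotz differential on `∂` is `∂̄⟨∂f, ∂f⟩`. -/
theorem klotz_conformal (g b : Plane → Matrix (Fin 2) (Fin 2) ℝ) (x : Plane) :
    dbar g b (fun _ => dz) x = cderiv (conjv dz) (fun y => cform (g y) dz dz) x := by
  have h : bracket (fun _ => conjv dz) (fun _ => dz) x = 0 := by
    funext k; simp [bracket, cderiv, pd]
  simp [dbar, h, cform]

/-- The Hermitian matrix of a vector of Minkowski four-space. -/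
def herm (x : E13) : Matrix (Fin 2) (Fin 2) ℂ :=
  !![(x 0 + x 1 : ℂ), x 3 - Complex.I * x 2; x 3 + Complex.I * x 2, (x 0 - x 1 : ℂ)]

/-- The Hermitian matrix of the second basis vector. -/
def pauli : Matrix (Fin 2) (Fin 2) ℂ := !![1, 0; 0, -1]

theorem mink_eq_det (x y : E13) :
    ((mink x y : ℝ) : ℂ) = -(1 / 2) * ((herm x + herm y).det - (herm x).det - (herm y).det) := by
  simp only [mink, herm, Matrix.det_fin_two, Matrix.add_apply, Matrix.of_apply, Matrix.cons_val',
    Matrix.cons_val_zero, Matrix.cons_val_one, Matrix.cons_val_fin_one]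
  push_cast
  linear_combination ((x 2 : ℂ) * y 2) * Complex.I_sq

/-- The scalar product of the vectors with matrices `g A g*` and `g B g*`, for `det g = 1`. -/
theorem mink_action (g A B : Matrix (Fin 2) (Fin 2) ℂ) (hg : g.det = 1) (x y : E13)
    (hx : herm x = g * A * gᴴ) (hy : herm y = g * B * gᴴ) :
    ((mink x y : ℝ) : ℂ) = -(1 / 2) * ((A + B).det - A.det - B.det) := by
  have key : ∀ C : Matrix (Fin 2) (Fin 2) ℂ, (g * C * gᴴ).det = C.det := by
    intro C; simp [Matrix.det_mul, Matrix.det_conjTranspose, hg]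
  rw [mink_eq_det, hx, hy, ← Matrix.add_mul, ← Matrix.mul_add, key, key, key]

theorem mink_action_re (g A B : Matrix (Fin 2) (Fin 2) ℂ) (hg : g.det = 1) (x y : E13)
    (hx : herm x = g * A * gᴴ) (hy : herm y = g * B * gᴴ) :
    mink x y = (-(1 / 2) * ((A + B).det - A.det - B.det)).re := by
  rw [← mink_action g A B hg x y hx hy, Complex.ofReal_re]

/-- Justification of `unitMetric`: at the point `g • (e₀, e₁) = (g g*, g e₁ g*)` of `UH3`, the
tangent vector represented by `Y` in the complement of the Lie algebra of `U₁` is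
`(g (Y + Y*) g*, g (Y e₁ + e₁ Y*) g*)`, and the metric is `Re (tr (Y Y')) / 2`. -/
theorem unitMetric_eq_killing (g Y Y' : Matrix (Fin 2) (Fin 2) ℂ) (hg : g.det = 1)
    (hY : Y 1 1 = -Y 0 0) (hY' : Y' 1 1 = -Y' 0 0)
    (hr : (Y 0 0).im = 0) (hr' : (Y' 0 0).im = 0) (b w w' : E13 × E13)
    (hb : herm b.2 = g * pauli * gᴴ)
    (h1 : herm w.1 = g * (Y + Yᴴ) * gᴴ) (h2 : herm w.2 = g * (Y * pauli + pauli * Yᴴ) * gᴴ)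
    (h1' : herm w'.1 = g * (Y' + Y'ᴴ) * gᴴ)
    (h2' : herm w'.2 = g * (Y' * pauli + pauli * Y'ᴴ) * gᴴ) :
    unitMetric b w w' = (1 / 2) * ((Y * Y').trace).re := by
  rw [unitMetric, mink_action_re g _ _ hg _ _ h1 h1', mink_action_re g _ _ hg _ _ h2 h2',
    mink_action_re g _ _ hg _ _ h1 hb, mink_action_re g _ _ hg _ _ h1' hb]
  simp [Matrix.det_fin_two, Matrix.trace_fin_two, Matrix.mul_apply, Matrix.vecMul, dotProduct, pauli, hY, hY', hr, hr']
  ring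

theorem biForm_wedge (x v y w : E13) :
    biForm (wedge x v) (wedge y w) = mink x y * mink v w - mink x w * mink v y := by
  simp [biForm, wedge, mink, sgn, Fin.sum_univ_four]
  ring

theorem biForm_add (A B C D : Bivector) :
    biForm (A + B) (C + D) = biForm A C + biForm A D + biForm B C + biForm B D := by
  simp [biForm, Fin.sum_univ_four]
  ring

/-- Justification of `geoMetric`: the tangent vector of `Geo` at `g • (e₀ ∧ e₁)` represented by an
off-diagonal matrix `Y` has square norm `Re (tr (Y Y)) / 2`. -/
theorem geoMetric_eq_killing (g Y Y' : Matrix (Fin 2) (Fin 2) ℂ) (hg : g.det = 1)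
    (hY : Y 0 0 = 0 ∧ Y 1 1 = 0) (hY' : Y' 0 0 = 0 ∧ Y' 1 1 = 0)
    (b w w' : E13 × E13) (hb1 : herm b.1 = g * 1 * gᴴ) (hb : herm b.2 = g * pauli * gᴴ)
    (h1 : herm w.1 = g * (Y + Yᴴ) * gᴴ) (h2 : herm w.2 = g * (Y * pauli + pauli * Yᴴ) * gᴴ)
    (h1' : herm w'.1 = g * (Y' + Y'ᴴ) * gᴴ)
    (h2' : herm w'.2 = g * (Y' * pauli + pauli * Y'ᴴ) * gᴴ) :
    geoMetric (wedge b.1 b.2) (wedge w.1 b.2 + wedge b.1 w.2) (wedge w'.1 b.2 + wedge b.1 w'.2)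
      = (1 / 2) * ((Y * Y').trace).re := by
  obtain ⟨hY0, hY1⟩ := hY
  obtain ⟨hY0', hY1'⟩ := hY'
  rw [geoMetric, biForm_add, biForm_wedge, biForm_wedge, biForm_wedge, biForm_wedge,
    mink_action_re g _ _ hg _ _ h1 h1', mink_action_re g _ _ hg _ _ h2 h2',
    mink_action_re g _ _ hg _ _ h1 hb, mink_action_re g _ _ hg _ _ hb h1',
    mink_action_re g _ _ hg _ _ h1 hb1, mink_action_re g _ _ hg _ _ hb1 h1',
    mink_action_re g _ _ hg _ _ hb hb, mink_action_re g _ _ hg _ _ hb1 hb1,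
    mink_action_re g _ _ hg _ _ hb hb1, mink_action_re g _ _ hg _ _ hb1 hb,
    mink_action_re g _ _ hg _ _ h1 h2', mink_action_re g _ _ hg _ _ h2 h1',
    mink_action_re g _ _ hg _ _ hb h2', mink_action_re g _ _ hg _ _ h2 hb,
    mink_action_re g _ _ hg _ _ hb1 h2', mink_action_re g _ _ hg _ _ h2 hb1]
  simp [Matrix.det_fin_two, Matrix.trace_fin_two, Matrix.mul_apply, Matrix.vecMul, dotProduct, pauli, hY0, hY1, hY0', hY1']
  ring

end HypSurf

end

/-! Put D = det II / det I (`detRatio`). The Gauss equation reads K = D - 1. Hence K > -1 makes II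
definite, and each of the four statements turns out to be equivalent to dD = 0 (`IsStationary`),
which on a connected surface means that K is constant.

Let Δ denote the Laplacian of II times its area density (`divGrad` with `Definite.dens`), acting on
vector-valued maps. The decisive identity is `Definite.mink_divGrad_pd`: up to that density, the
tangential part of Δf is -1/2 times the II-gradient of log D. The reason is that this part is the
II-trace of the difference of the Levi-Civita connections of I and II. By the Codazzi equations the
covariant derivative of II is totally symmetric, so the trace is the differential of the logarithm
of a ratio of determinants. Thus dD = 0 exactly when Δf has no tangential part. Interchanging f and
n keeps II and turns D into 1/D, so the same then holds for Δn.

The metrics of both targets are restrictions of constant bilinear forms, except for the term ⟨dx,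
v⟩² of `unitMetric`, which has no first-order effect because (f, n) is Legendrian. So the first
variation (`hasDerivAt_energy`) pairs the variation field with the ambient Laplacian. If dD = 0,
then Δf and Δn lie in the span of f and n, and ⟨Δf, n⟩ = ⟨Δn, f⟩, which makes Δ(f, n) normal to
`UH3`. Moreover Δ(f ∧ n) is a multiple of f ∧ n, hence normal to `Geo`. Conversely, varying by
Lorentz transformations with a cut-off parameter gives f ∧ Δf = n ∧ Δn for either Gauss map, and
pairing this with f ∧ ∂ₖf leaves the tangential part of Δf (`Definite.tangent_eq_zero_of_wedge`).

For the Klotz differential, ∂̄⟨∂f, ∂f⟩ = 2⟨∂̄∂f, ∂f⟩ in a conformal coordinate, a multiple of ⟨Δf,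
∂f⟩. `Definite.dbar_eq` is the same identity for an arbitrary isotropic field, so that no conformal
coordinate has to be constructed. -/

namespace HypSurf

/-! ### Rules for partial derivatives on open subsets of the plane. -/

section Calculus

variable {V W Z : Type*} [NormedAddCommGroup V] [NormedSpace ℝ V] [NormedAddCommGroup W]
  [NormedSpace ℝ W] [NormedAddCommGroup Z] [NormedSpace ℝ Z]

/-- Partial derivatives of smooth maps on open sets are smooth. -/
theorem contDiffOn_pd {U : Set Plane} (hU : IsOpen U) {φ : Plane → V} (hφ : ContDiffOn ℝ ∞ φ U)
    (i : Fin 2) : ContDiffOn ℝ ∞ (pd i φ) U :=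
  (hφ.fderiv_of_isOpen (m := ∞) hU (by simp)).clm_apply contDiffOn_const

theorem diffAt_of_contDiffOn {U : Set Plane} (hU : IsOpen U) {φ : Plane → V}
    (hφ : ContDiffOn ℝ ∞ φ U) {x : Plane} (hx : x ∈ U) : DifferentiableAt ℝ φ x :=
  (hφ.contDiffAt (hU.mem_nhds hx)).differentiableAt (by simp)

/-- The standard way below to differentiate an identity that holds only on the coordinate domain. -/
theorem pd_congr {U : Set Plane} (hU : IsOpen U) {φ ψ : Plane → V} (h : ∀ y ∈ U, φ y = ψ y)
    {x : Plane} (hx : x ∈ U) (i : Fin 2) : pd i φ x = pd i ψ x := by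
  have : φ =ᶠ[nhds x] ψ := by filter_upwards [hU.mem_nhds hx] with y hy using h y hy
  rw [pd, pd, this.fderiv_eq]

theorem pd_const (i : Fin 2) (c : V) (x : Plane) : pd i (fun _ => c) x = 0 := by simp [pd]

theorem pd_bilin (B : V →L[ℝ] W →L[ℝ] Z) {φ : Plane → V} {ψ : Plane → W} {x : Plane}
    (hφ : DifferentiableAt ℝ φ x) (hψ : DifferentiableAt ℝ ψ x) (i : Fin 2) :
    pd i (fun y => B (φ y) (ψ y)) x = B (pd i φ x) (ψ x) + B (φ x) (pd i ψ x) := by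
  have := (B.hasFDerivAt_of_bilinear hφ.hasFDerivAt hψ.hasFDerivAt).fderiv
  simp only [pd]
  rw [this]
  simp [add_comm]

theorem pd_clm (B : V →L[ℝ] W) {φ : Plane → V} {x : Plane}
    (hφ : DifferentiableAt ℝ φ x) (i : Fin 2) :
    pd i (fun y => B (φ y)) x = B (pd i φ x) := by
  have := (B.hasFDerivAt.comp x hφ.hasFDerivAt).fderiv
  simp only [pd]
  change fderiv ℝ (B ∘ φ) x _ = _
  rw [this]; rfl

theorem pd_smul {a : Plane → ℝ} {φ : Plane → V} {x : Plane} (ha : DifferentiableAt ℝ a x)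
    (hφ : DifferentiableAt ℝ φ x) (i : Fin 2) :
    pd i (fun y => a y • φ y) x = pd i a x • φ x + a x • pd i φ x :=
  pd_bilin (ContinuousLinearMap.lsmul ℝ ℝ) ha hφ i

theorem pd_mul {a b : Plane → ℝ} {x : Plane} (ha : DifferentiableAt ℝ a x)
    (hb : DifferentiableAt ℝ b x) (i : Fin 2) :
    pd i (fun y => a y * b y) x = pd i a x * b x + a x * pd i b x :=
  pd_smul ha hb i

theorem pd_cmul {a b : Plane → ℂ} {x : Plane} (ha : DifferentiableAt ℝ a x)
    (hb : DifferentiableAt ℝ b x) (i : Fin 2) :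
    pd i (fun y => a y * b y) x = pd i a x * b x + a x * pd i b x :=
  pd_bilin (ContinuousLinearMap.mul ℝ ℂ) ha hb i

theorem pd_add {φ ψ : Plane → V} {x : Plane} (hφ : DifferentiableAt ℝ φ x)
    (hψ : DifferentiableAt ℝ ψ x) (i : Fin 2) :
    pd i (fun y => φ y + ψ y) x = pd i φ x + pd i ψ x := by
  simp only [pd]
  rw [fderiv_fun_add hφ hψ]; rfl

theorem pd_sub {φ ψ : Plane → V} {x : Plane} (hφ : DifferentiableAt ℝ φ x)
    (hψ : DifferentiableAt ℝ ψ x) (i : Fin 2) :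
    pd i (fun y => φ y - ψ y) x = pd i φ x - pd i ψ x := by
  simp only [pd]
  rw [fderiv_fun_sub hφ hψ]; rfl

theorem pd_neg (φ : Plane → V) (x : Plane) (i : Fin 2) :
    pd i (fun y => -φ y) x = -pd i φ x := by
  simp only [pd]
  rw [fderiv_fun_neg]; rfl

theorem pd_sum {ι : Type*} (s : Finset ι) {φ : ι → Plane → V} {x : Plane}
    (hφ : ∀ j ∈ s, DifferentiableAt ℝ (φ j) x) (i : Fin 2) :
    pd i (fun y => ∑ j ∈ s, φ j y) x = ∑ j ∈ s, pd i (φ j) x := by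
  simp only [pd]
  rw [fderiv_fun_sum hφ]; simp

/-- Mixed partial derivatives agree. -/
theorem pd_comm {U : Set Plane} (hU : IsOpen U) {φ : Plane → V} (hφ : ContDiffOn ℝ ∞ φ U)
    {x : Plane} (hx : x ∈ U) (i j : Fin 2) : pd i (pd j φ) x = pd j (pd i φ) x := by
  have h2 : ContDiffAt ℝ ∞ φ x := hφ.contDiffAt (hU.mem_nhds hx)
  have hd : DifferentiableAt ℝ (fderiv ℝ φ) x :=
    ((hφ.fderiv_of_isOpen (m := ∞) hU (by simp)).contDiffAt (hU.mem_nhds hx)).differentiableAt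
      (by simp)
  have key : ∀ i j : Fin 2, pd i (pd j φ) x
      = fderiv ℝ (fderiv ℝ φ) x (EuclideanSpace.single i 1) (EuclideanSpace.single j 1) := by
    intro i j
    have := (hd.hasFDerivAt.clm_apply
      (hasFDerivAt_const (EuclideanSpace.single j (1 : ℝ)) x)).fderiv
    change fderiv ℝ (fun y => fderiv ℝ φ y (EuclideanSpace.single j 1)) x _ = _
    rw [this]; simp
  rw [key, key]
  exact (h2.isSymmSndFDerivAt
    (by simpa using WithTop.coe_le_coe.2 (le_top : (2 : ℕ∞) ≤ ⊤))).eq _ _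

end Calculus

/-! ### The scalar products as continuous bilinear maps. -/

/-- The Lorentzian scalar product as a continuous bilinear map. -/
noncomputable def minkL : E13 →L[ℝ] E13 →L[ℝ] ℝ :=
  (LinearMap.mk₂ ℝ mink (by intros; simp [mink]; ring) (by intros; simp [mink]; ring)
    (by intros; simp [mink]; ring) (by intros; simp [mink]; ring)).toContinuousBilinearMap

theorem mink_comm (x y : E13) : mink x y = mink y x := by simp only [mink]; ring

theorem mink_add_left (x y z : E13) : mink (x + y) z = mink x z + mink y z := by
  simp only [mink, Pi.add_apply]; ring

theorem mink_add_right (x y z : E13) : mink x (y + z) = mink x y + mink x z := by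
  simp only [mink, Pi.add_apply]; ring

theorem mink_smul_left (c : ℝ) (x y : E13) : mink (c • x) y = c * mink x y := by
  simp only [mink, Pi.smul_apply, smul_eq_mul]; ring

theorem mink_smul_right (c : ℝ) (x y : E13) : mink x (c • y) = c * mink x y := by
  simp only [mink, Pi.smul_apply, smul_eq_mul]; ring

theorem pd_mink {φ ψ : Plane → E13} {x : Plane} (hφ : DifferentiableAt ℝ φ x)
    (hψ : DifferentiableAt ℝ ψ x) (i : Fin 2) :
    pd i (fun y => mink (φ y) (ψ y)) x = mink (pd i φ x) (ψ x) + mink (φ x) (pd i ψ x) :=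
  pd_bilin minkL hφ hψ i

theorem contDiffOn_mink {U : Set Plane} {φ ψ : Plane → E13} (hφ : ContDiffOn ℝ ∞ φ U)
    (hψ : ContDiffOn ℝ ∞ ψ U) : ContDiffOn ℝ ∞ (fun y => mink (φ y) (ψ y)) U :=
  (minkL.contDiff.comp_contDiffOn hφ).clm_apply hψ

/-- The bivector `x ∧ v` as a continuous bilinear map. -/
noncomputable def wedgeL : E13 →L[ℝ] E13 →L[ℝ] Bivector :=
  (LinearMap.mk₂ ℝ wedge (by intros; ext; simp [wedge]; ring) (by intros; ext; simp [wedge]; ring)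
    (by intros; ext; simp [wedge]; ring)
    (by intros; ext; simp [wedge]; ring)).toContinuousBilinearMap

/-- A quarter of the scalar product of bivectors as a continuous bilinear map. -/
noncomputable def geoL : Bivector →L[ℝ] Bivector →L[ℝ] ℝ :=
  (LinearMap.mk₂ ℝ (geoMetric 0) (by intros; simp [geoMetric, biForm, Fin.sum_univ_four]; ring)
    (by intros; simp [geoMetric, biForm, Fin.sum_univ_four]; ring)
    (by intros; simp [geoMetric, biForm, Fin.sum_univ_four]; ring)
    (by intros; simp [geoMetric, biForm, Fin.sum_univ_four]; ring)).toContinuousBilinearMap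

theorem geoL_apply (A B : Bivector) : geoL A B = 1 / 4 * biForm A B := rfl

/-- The bilinear form `(⟨x, y⟩ - ⟨v, w⟩) / 4` on pairs of vectors. -/
noncomputable def unitL : E13 × E13 →L[ℝ] E13 × E13 →L[ℝ] ℝ :=
  (LinearMap.mk₂ ℝ (fun w w' : E13 × E13 => 1 / 4 * (mink w.1 w'.1 - mink w.2 w'.2))
    (by intros; simp [mink]; ring) (by intros; simp [mink]; ring)
    (by intros; simp [mink]; ring) (by intros; simp [mink]; ring)).toContinuousBilinearMap

theorem unitL_apply (w w' : E13 × E13) :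
    unitL w w' = 1 / 4 * (mink w.1 w'.1 - mink w.2 w'.2) := rfl

/-- The bilinear form `⟨b.2, w.1⟩` on pairs of vectors. -/
noncomputable def crossL : E13 × E13 →L[ℝ] E13 × E13 →L[ℝ] ℝ :=
  (LinearMap.mk₂ ℝ (fun b w : E13 × E13 => mink w.1 b.2)
    (by intros; simp [mink]; ring) (by intros; simp [mink]; ring)
    (by intros; simp [mink]; ring) (by intros; simp [mink]; ring)).toContinuousBilinearMap

theorem crossL_apply (b w : E13 × E13) : crossL b w = mink w.1 b.2 := rfl

/-! ### Integration by parts and differentiation under the integral. -/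

/-- The integral of a partial derivative of a function with compact support vanishes. -/
theorem setIntegral_pd_eq_zero {U C : Set Plane} (hU : IsOpen U) (hC : IsCompact C) (hCU : C ⊆ U)
    {w : Plane → ℝ} (hw : ContDiffOn ℝ ∞ w U) (h0 : ∀ x ∈ U \ C, w x = 0) (i : Fin 2) :
    ∫ x in C, pd i w x = 0 := by
  -- Extension by zero is smooth on the whole plane: near points of `C` it agrees with `w`, and off
  -- the closed set `C` it is locally zero.
  set v := C.indicator w with hv
  have hvU : ∀ y ∈ U, v y = w y := fun y hy => by
    by_cases hyC : y ∈ C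
    · exact indicator_of_mem hyC w
    · rw [hv, indicator_of_notMem hyC, h0 y ⟨hy, hyC⟩]
  have hvC : ∀ y ∈ Cᶜ, v y = 0 := fun y hy => indicator_of_notMem hy w
  have hsm : ContDiff ℝ ∞ v := by
    rw [contDiff_iff_contDiffAt]
    intro x
    by_cases hx : x ∈ C
    · have h := hU.mem_nhds (hCU hx)
      exact (hw.contDiffAt h).congr_of_eventuallyEq (by filter_upwards [h] with y hy using hvU y hy)
    · have h := hC.isClosed.isOpen_compl.mem_nhds hx
      exact (contDiffAt_const (c := (0 : ℝ))).congr_of_eventuallyEq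
        (by filter_upwards [h] with y hy using hvC y hy)
  have hcs : HasCompactSupport v := HasCompactSupport.intro hC hvC
  have hd : Continuous (pd i v) := (hsm.continuous_fderiv (by simp)).clm_apply continuous_const
  have hpC : ∀ y ∈ Cᶜ, pd i v y = 0 := fun y hy => by
    rw [pd_congr hC.isClosed.isOpen_compl hvC hy, pd_const]
  have hdcs : HasCompactSupport (pd i v) := HasCompactSupport.intro hC hpC
  -- Integration by parts against the constant function 1.
  have key := integral_mul_fderiv_eq_neg_fderiv_mul_of_integrable (μ := (volume : Measure Plane))
    (f := fun _ => (1 : ℝ)) (g := v) (v := EuclideanSpace.single i 1) (by simp)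
    (by simp only [one_mul]; exact hd.integrable_of_hasCompactSupport hdcs)
    (by simp only [one_mul]; exact hsm.continuous.integrable_of_hasCompactSupport hcs)
    (fun _ _ => differentiableAt_const _) (fun _ _ => hsm.differentiable (by simp) _)
  rw [setIntegral_congr_fun hC.measurableSet
    (fun x hx => (pd_congr hU hvU (hCU hx) i).symm),
    setIntegral_eq_integral_of_forall_compl_eq_zero hpC]
  simpa [pd] using key

/-- Differentiation under the integral sign over a compact set. -/
theorem hasDerivAt_setIntegral {U C : Set Plane} (hU : IsOpen U) (hC : IsCompact C) (hCU : C ⊆ U)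
    {ε : ℝ} (hε : 0 < ε) {d : ℝ × Plane → ℝ} (hd : ContDiffOn ℝ ∞ d (Ioo (-ε) ε ×ˢ U)) :
    HasDerivAt (fun s => ∫ x in C, d (s, x)) (∫ x in C, fderiv ℝ d (0, x) (1, 0)) 0 := by
  have hO : IsOpen (Ioo (-ε) ε ×ˢ U) := isOpen_Ioo.prod hU
  -- The parameter interval is halved to get a compact product, on which the derivative has a
  -- uniform bound that serves as the dominating function.
  have hsub : Icc (-(ε / 2)) (ε / 2) ×ˢ C ⊆ Ioo (-ε) ε ×ˢ U :=
    prod_mono (fun t ht => ⟨by linarith [ht.1], by linarith [ht.2]⟩) hCU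
  have hdd : ContinuousOn (fun q => fderiv ℝ d q ((1 : ℝ), (0 : Plane))) (Ioo (-ε) ε ×ˢ U) :=
    (hd.continuousOn_fderiv_of_isOpen hO (by simp)).clm_apply continuousOn_const
  obtain ⟨b, hb⟩ := (isCompact_Icc.prod hC).exists_bound_of_continuousOn (hdd.mono hsub)
  have hslice : ∀ s ∈ Ioo (-ε) ε, ∀ q : ℝ × Plane → ℝ, ContinuousOn q (Ioo (-ε) ε ×ˢ U) →
      ContinuousOn (fun x => q (s, x)) C := fun s hs q hq =>
    hq.comp (by fun_prop) (fun x hx => ⟨hs, hCU hx⟩)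
  have h0 : (0 : ℝ) ∈ Ioo (-ε) ε := ⟨by linarith, hε⟩
  have hdc := hd.continuousOn
  refine (hasDerivAt_integral_of_dominated_loc_of_deriv_le (bound := fun _ => b)
    (F' := fun s x => fderiv ℝ d (s, x) (1, 0))
    (Icc_mem_nhds (show -(ε / 2) < 0 by linarith) (show 0 < ε / 2 by linarith)) ?_ ?_ ?_ ?_ ?_ ?_).2
  · filter_upwards [Ioo_mem_nhds h0.1 h0.2] with s hs
    exact (hslice s hs d hdc).aestronglyMeasurable hC.measurableSet
  · exact (hslice 0 h0 d hdc).integrableOn_compact hC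
  · exact (hslice 0 h0 _ hdd).aestronglyMeasurable hC.measurableSet
  · exact ae_restrict_of_forall_mem hC.measurableSet fun x hx s hs => hb (s, x) ⟨hs, hx⟩
  · exact integrableOn_const hC.measure_lt_top.ne
  · refine ae_restrict_of_forall_mem hC.measurableSet fun x hx s hs => ?_
    have hq : DifferentiableAt ℝ d (s, x) :=
      (hd.contDiffAt (hO.mem_nhds (hsub ⟨hs, hx⟩))).differentiableAt (by simp)
    exact hq.hasFDerivAt.comp_hasDerivAt s ((hasDerivAt_id s).prodMk (hasDerivAt_const s x))

/-- The operator `∑ᵢ ∂ᵢ (∑ⱼ Pⁱʲ ∂ⱼ φ)`. If `P = √(det h) h⁻¹`, it is the Laplacian of the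
metric `h` times the volume density of `h`. -/
noncomputable def divGrad {V : Type*} [NormedAddCommGroup V] [NormedSpace ℝ V]
    (P : Plane → Matrix (Fin 2) (Fin 2) ℝ) (φ : Plane → V) (x : Plane) : V :=
  ∑ i, pd i (fun y => ∑ j, P y i j • pd j φ y) x

/-- The conformally invariant density `√(det h) h⁻¹` of the inverse metric. -/
noncomputable def invDensity (h : Matrix (Fin 2) (Fin 2) ℝ) : Matrix (Fin 2) (Fin 2) ℝ :=
  Real.sqrt h.det • h⁻¹

section DivGrad

variable {V : Type*} [NormedAddCommGroup V] [NormedSpace ℝ V]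

theorem energyDensity_eq (h : Matrix (Fin 2) (Fin 2) ℝ) (G : V → V → V → ℝ) (φ : Plane → V)
    (x : Plane) : energyDensity h G φ x
      = 1 / 2 * ∑ i, ∑ j, invDensity h i j * G (φ x) (pd i φ x) (pd j φ x) := by
  simp only [energyDensity, invDensity, Matrix.smul_apply, smul_eq_mul, Finset.mul_sum]
  ring_nf

theorem contDiffOn_flux {U : Set Plane} (hU : IsOpen U) {P : Plane → Matrix (Fin 2) (Fin 2) ℝ}
    (hP : ∀ i j, ContDiffOn ℝ ∞ (fun x => P x i j) U) {φ : Plane → V} (hφ : ContDiffOn ℝ ∞ φ U)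
    (i : Fin 2) : ContDiffOn ℝ ∞ (fun y => ∑ j, P y i j • pd j φ y) U :=
  ContDiffOn.sum fun j _ => (hP i j).smul (contDiffOn_pd hU hφ j)

theorem contDiffOn_divGrad {U : Set Plane} (hU : IsOpen U)
    {P : Plane → Matrix (Fin 2) (Fin 2) ℝ}
    (hP : ∀ i j, ContDiffOn ℝ ∞ (fun x => P x i j) U) {φ : Plane → V} (hφ : ContDiffOn ℝ ∞ φ U) :
    ContDiffOn ℝ ∞ (divGrad P φ) U :=
  ContDiffOn.sum fun i _ => contDiffOn_pd hU (contDiffOn_flux hU hP hφ i) i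

/-- Integration by parts for the Dirichlet form of `P` and a bilinear form `B`. -/
theorem setIntegral_dirichlet {U C : Set Plane} (hU : IsOpen U) (hC : IsCompact C) (hCU : C ⊆ U)
    (B : V →L[ℝ] V →L[ℝ] ℝ) {P : Plane → Matrix (Fin 2) (Fin 2) ℝ}
    (hP : ∀ i j, ContDiffOn ℝ ∞ (fun x => P x i j) U) {φ ψ : Plane → V}
    (hφ : ContDiffOn ℝ ∞ φ U) (hψ : ContDiffOn ℝ ∞ ψ U) (h0 : ∀ x ∈ U \ C, ψ x = 0) :
    ∫ x in C, ∑ i, ∑ j, P x i j * B (pd i ψ x) (pd j φ x)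
      = -∫ x in C, B (ψ x) (divGrad P φ x) := by
  -- A vector field supported in `C` whose divergence is the sum of the two integrands.
  set w : Fin 2 → Plane → ℝ := fun i y => B (ψ y) (∑ j, P y i j • pd j φ y) with hw
  have hwsm : ∀ i, ContDiffOn ℝ ∞ (w i) U := fun i =>
    (B.contDiff.comp_contDiffOn hψ).clm_apply (contDiffOn_flux hU hP hφ i)
  have hpw : ∀ x ∈ U, ∑ i, pd i (w i) x
      = (∑ i, ∑ j, P x i j * B (pd i ψ x) (pd j φ x)) + B (ψ x) (divGrad P φ x) := by
    intro x hx
    rw [divGrad, map_sum, ← Finset.sum_add_distrib]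
    refine Finset.sum_congr rfl fun i _ => ?_
    rw [hw, pd_bilin B (diffAt_of_contDiffOn hU hψ hx)
      (diffAt_of_contDiffOn hU (contDiffOn_flux hU hP hφ i) hx)]
    simp
  have hint : ∀ i, IntegrableOn (pd i (w i)) C := fun i =>
    ((contDiffOn_pd hU (hwsm i) i).continuousOn.mono hCU).integrableOn_compact hC
  have hzero : ∫ x in C, ∑ i, pd i (w i) x = 0 := by
    rw [integral_finsetSum _ fun i _ => hint i]
    exact Finset.sum_eq_zero fun i _ => setIntegral_pd_eq_zero hU hC hCU (hwsm i)
      (fun x hx => by simp [hw, h0 x hx]) i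
  have hB : IntegrableOn (fun x => B (ψ x) (divGrad P φ x)) C :=
    ((((B.contDiff.comp_contDiffOn hψ).clm_apply
      (contDiffOn_divGrad hU hP hφ)).continuousOn).mono hCU).integrableOn_compact hC
  rw [eq_neg_iff_add_eq_zero, ← integral_add _ hB, ← hzero]
  · exact setIntegral_congr_fun hC.measurableSet fun x hx => (hpw x (hCU hx)).symm
  · have : IntegrableOn (fun x => ∑ i, pd i (w i) x - B (ψ x) (divGrad P φ x)) C :=
      (integrable_finsetSum _ fun i _ => hint i).sub hB
    refine this.congr_fun (fun x hx => ?_) hC.measurableSet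
    simp only [hpw x (hCU hx), add_sub_cancel_right]

end DivGrad

/-! ### The first variation of the energy. -/

section FirstVariation

variable {V : Type*} [NormedAddCommGroup V] [NormedSpace ℝ V]

/-- The derivative in the parameter commutes with partial derivatives. -/
theorem hasDerivAt_partial {Ψ : ℝ × Plane → V} {x : Plane} (hΨ : ContDiffAt ℝ ∞ Ψ (0, x))
    (i : Fin 2) :
    HasDerivAt (fun s : ℝ => fderiv ℝ Ψ (s, x) (0, EuclideanSpace.single i 1))
      (pd i (fun y => fderiv ℝ Ψ (0, y) (1, 0)) x) 0 := by
  have hdd : HasFDerivAt (fderiv ℝ Ψ) (fderiv ℝ (fderiv ℝ Ψ) (0, x)) (0, x) :=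
    ((hΨ.fderiv_right (m := ∞) (by simp)).differentiableAt (by simp)).hasFDerivAt
  have hline : HasDerivAt (fun s : ℝ => (s, x)) ((1 : ℝ), (0 : Plane)) 0 :=
    (hasDerivAt_id (0 : ℝ)).prodMk (hasDerivAt_const 0 x)
  have h1 : HasFDerivAt (fun y : Plane => ((0 : ℝ), y)) (ContinuousLinearMap.inr ℝ ℝ Plane) x :=
    hasFDerivAt_prodMk_right 0 x
  have e1 : HasDerivAt (fun s : ℝ => fderiv ℝ Ψ (s, x))
      (fderiv ℝ (fderiv ℝ Ψ) (0, x) (1, 0)) 0 :=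
    HasFDerivAt.comp_hasDerivAt (l := fderiv ℝ Ψ) 0 hdd hline
  have e2 : HasFDerivAt (fun y : Plane => fderiv ℝ Ψ (0, y))
      ((fderiv ℝ (fderiv ℝ Ψ) (0, x)).comp (ContinuousLinearMap.inr ℝ ℝ Plane)) x :=
    HasFDerivAt.comp (g := fderiv ℝ Ψ) x hdd h1
  have e1' := ((ContinuousLinearMap.apply ℝ V ((0 : ℝ), (EuclideanSpace.single i (1 : ℝ) : Plane)))
    |>.hasFDerivAt).comp_hasDerivAt 0 e1
  have e2' := ((ContinuousLinearMap.apply ℝ V ((1 : ℝ), (0 : Plane))).hasFDerivAt).comp x e2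
  have e3 : pd i (fun y => fderiv ℝ Ψ (0, y) (1, 0)) x
      = fderiv ℝ (fderiv ℝ Ψ) (0, x) (0, EuclideanSpace.single i 1) (1, 0) := by
    change fderiv ℝ ((ContinuousLinearMap.apply ℝ V ((1 : ℝ), (0 : Plane)))
      ∘ fun y : Plane => fderiv ℝ Ψ (0, y)) x _ = _
    rw [e2'.fderiv]; rfl
  have hsy := (hΨ.isSymmSndFDerivAt
    (by simpa using WithTop.coe_le_coe.2 (le_top : (2 : ℕ∞) ≤ ⊤))).eq
      ((0 : ℝ), (EuclideanSpace.single i (1 : ℝ) : Plane)) (1, 0)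
  rw [e3, hsy]
  exact e1'

/-- The first variation of the energy, for metrics that differ from a constant bilinear form by the
square of a form that vanishes on the derivatives of the map. -/
theorem hasDerivAt_energy (B ℓ : V →L[ℝ] V →L[ℝ] ℝ) (hB : ∀ u v, B u v = B v u) (κ : ℝ)
    {G : V → V → V → ℝ} (hG : ∀ b w w', G b w w' = B w w' - κ * (ℓ b w * ℓ b w'))
    {U C : Set Plane} (hU : IsOpen U) (hC : IsCompact C) (hCU : C ⊆ U) {ε : ℝ} (hε : 0 < ε)
    {h : Plane → Matrix (Fin 2) (Fin 2) ℝ}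
    (hP : ∀ i j, ContDiffOn ℝ ∞ (fun x => invDensity (h x) i j) U)
    (hsymm : ∀ x, invDensity (h x) 1 0 = invDensity (h x) 0 1)
    {φ : Plane → V} (hφ : ContDiffOn ℝ ∞ φ U) (hℓ : ∀ x ∈ U, ∀ i, ℓ (φ x) (pd i φ x) = 0)
    {Φ : ℝ → Plane → V}
    (hΦ : ContDiffOn ℝ ∞ (fun q : ℝ × Plane => Φ q.1 q.2) (Ioo (-ε) ε ×ˢ U))
    (hΦ0 : ∀ x ∈ U, Φ 0 x = φ x) (hout : ∀ s ∈ Ioo (-ε) ε, ∀ x ∈ U \ C, Φ s x = φ x) :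
    HasDerivAt (fun s => ∫ x in C, energyDensity (h x) G (Φ s) x)
      (-∫ x in C, B (deriv (fun s => Φ s x) 0) (divGrad (fun y => invDensity (h y)) φ x)) 0 := by
  have hO : IsOpen (Ioo (-ε) ε ×ˢ U) := isOpen_Ioo.prod hU
  have h0 : (0 : ℝ) ∈ Ioo (-ε) ε := ⟨by linarith, hε⟩
  set Ψ : ℝ × Plane → V := fun q => Φ q.1 q.2 with hΨ
  have hΨd : ∀ q ∈ Ioo (-ε) ε ×ˢ U, HasFDerivAt Ψ (fderiv ℝ Ψ q) q := fun q hq =>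
    ((hΦ.contDiffAt (hO.mem_nhds hq)).differentiableAt (by simp)).hasFDerivAt
  have hΨ' : ContDiffOn ℝ ∞ (fderiv ℝ Ψ) (Ioo (-ε) ε ×ˢ U) :=
    hΦ.fderiv_of_isOpen (m := ∞) hO (by simp)
  set D : Fin 2 → ℝ × Plane → V := fun i q => fderiv ℝ Ψ q (0, EuclideanSpace.single i 1) with hD
  have hDsm : ∀ i, ContDiffOn ℝ ∞ (D i) (Ioo (-ε) ε ×ˢ U) := fun i =>
    hΨ'.clm_apply contDiffOn_const
  have hpd : ∀ s ∈ Ioo (-ε) ε, ∀ x ∈ U, ∀ i, pd i (Φ s) x = D i (s, x) := by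
    intro s hs x hx i
    have h1 : HasFDerivAt (fun y : Plane => (s, y)) (ContinuousLinearMap.inr ℝ ℝ Plane) x :=
      hasFDerivAt_prodMk_right s x
    have h2 := (hΨd (s, x) ⟨hs, hx⟩).comp x h1
    change fderiv ℝ (Ψ ∘ fun y => (s, y)) x _ = _
    rw [h2.fderiv]; simp [hD]
  set ψ : Plane → V := fun x => fderiv ℝ Ψ (0, x) (1, 0) with hψ
  have hpair : ContDiffOn ℝ ∞ (fun x : Plane => ((0 : ℝ), x)) U := by fun_prop
  have hmaps : MapsTo (fun x : Plane => ((0 : ℝ), x)) U (Ioo (-ε) ε ×ˢ U) := fun x hx => ⟨h0, hx⟩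
  have hψsm : ContDiffOn ℝ ∞ ψ U := (hΨ'.comp hpair hmaps).clm_apply contDiffOn_const
  have hline : ∀ x, HasDerivAt (fun s : ℝ => (s, x)) ((1 : ℝ), (0 : Plane)) 0 := fun x =>
    (hasDerivAt_id (0 : ℝ)).prodMk (hasDerivAt_const 0 x)
  have hψd : ∀ x ∈ U, HasDerivAt (fun s => Φ s x) (ψ x) 0 := fun x hx =>
    HasFDerivAt.comp_hasDerivAt (l := Ψ) 0 (hΨd (0, x) ⟨h0, hx⟩) (hline x)
  have hψ0 : ∀ x ∈ U \ C, ψ x = 0 := by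
    intro x hx
    have : (fun s => Φ s x) =ᶠ[nhds 0] fun _ => φ x := by
      filter_upwards [Ioo_mem_nhds h0.1 h0.2] with s hs using hout s hs x hx
    exact (hψd x hx.1).unique ((hasDerivAt_const 0 (φ x)).congr_of_eventuallyEq this)
  have hDt : ∀ x ∈ U, ∀ i, HasDerivAt (fun s => D i (s, x)) (pd i ψ x) 0 := fun x hx i =>
    hasDerivAt_partial (hΦ.contDiffAt (hO.mem_nhds ⟨h0, hx⟩)) i
  -- The energy density as a function of parameter and point jointly, with total derivatives of `Ψ`
  -- in place of partial derivatives of the slices.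
  set d : ℝ × Plane → ℝ := fun q => 1 / 2 * ∑ i, ∑ j, invDensity (h q.2) i j *
    (B (D i q) (D j q) - κ * (ℓ (Ψ q) (D i q) * ℓ (Ψ q) (D j q))) with hd
  have hsnd : ContDiffOn ℝ ∞ (Prod.snd : ℝ × Plane → Plane) (Ioo (-ε) ε ×ˢ U) :=
    contDiff_snd.contDiffOn
  have hℓsm : ∀ i, ContDiffOn ℝ ∞ (fun q => ℓ (Ψ q) (D i q)) (Ioo (-ε) ε ×ˢ U) := fun i =>
    (ℓ.contDiff.comp_contDiffOn hΦ).clm_apply (hDsm i)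
  have hdsm : ContDiffOn ℝ ∞ d (Ioo (-ε) ε ×ˢ U) := by
    refine contDiffOn_const.mul (ContDiffOn.sum fun i _ => ContDiffOn.sum fun j _ => ?_)
    refine ((hP i j).comp hsnd fun q hq => hq.2).mul ?_
    exact ((B.contDiff.comp_contDiffOn (hDsm i)).clm_apply (hDsm j)).sub
      (contDiffOn_const.mul ((hℓsm i).mul (hℓsm j)))
  have key := hasDerivAt_setIntegral hU hC hCU hε hdsm
  have hval : ∀ x ∈ C, fderiv ℝ d (0, x) (1, 0)
      = ∑ i, ∑ j, invDensity (h x) i j * B (pd i ψ x) (pd j φ x) := by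
    intro x hxC
    have hx := hCU hxC
    have hq : (0, x) ∈ Ioo (-ε) ε ×ˢ U := ⟨h0, hx⟩
    have hd1 := (((hdsm.contDiffAt (hO.mem_nhds hq)).differentiableAt
      (by simp)).hasFDerivAt).comp_hasDerivAt 0 (hline x)
    have hD0 : ∀ i, D i (0, x) = pd i φ x := fun i => by
      rw [← hpd 0 h0 x hx, pd_congr hU hΦ0 hx]
    have hl : ∀ i, HasDerivAt (fun s => ℓ (Φ s x) (D i (s, x)))
        (ℓ (ψ x) (D i (0, x)) + ℓ (Φ 0 x) (pd i ψ x)) 0 := fun i =>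
      (ℓ.hasFDerivAt.comp_hasDerivAt 0 (hψd x hx)).clm_apply (hDt x hx i)
    -- Both factors of each product of `ℓ`-terms vanish at parameter zero, so these products have
    -- derivative zero there, whatever the variation.
    have hl0 : ∀ i, ℓ (Φ 0 x) (pd i φ x) = 0 := fun i => by rw [hΦ0 x hx, hℓ x hx]
    have hb : ∀ i j, HasDerivAt (fun s => B (D i (s, x)) (D j (s, x)))
        (B (pd i ψ x) (D j (0, x)) + B (D i (0, x)) (pd j ψ x)) 0 := fun i j =>
      (B.hasFDerivAt.comp_hasDerivAt 0 (hDt x hx i)).clm_apply (hDt x hx j)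
    have hsum := (HasDerivAt.fun_sum (u := Finset.univ) fun i _ =>
      HasDerivAt.fun_sum (u := Finset.univ) fun j _ =>
        ((hb i j).sub (((hl i).mul (hl j)).const_mul κ)).const_mul
          (invDensity (h x) i j)).const_mul (1 / 2 : ℝ)
    rw [hd1.unique hsum]
    simp only [hl0, hD0, Fin.sum_univ_two, hsymm x, mul_zero, zero_mul, add_zero, sub_zero]
    rw [hB (pd 0 φ x) (pd 0 ψ x), hB (pd 0 φ x) (pd 1 ψ x), hB (pd 1 φ x) (pd 0 ψ x),
      hB (pd 1 φ x) (pd 1 ψ x)]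
    ring
  rw [setIntegral_congr_fun hC.measurableSet hval,
    setIntegral_dirichlet hU hC hCU B hP hφ hψsm hψ0] at key
  have hderiv : ∫ x in C, B (deriv (fun s => Φ s x) 0) (divGrad (fun y => invDensity (h y)) φ x)
      = ∫ x in C, B (ψ x) (divGrad (fun y => invDensity (h y)) φ x) :=
    setIntegral_congr_fun hC.measurableSet fun x hx => by
      simp only [(hψd x (hCU hx)).deriv]
  rw [hderiv]
  refine key.congr_of_eventuallyEq ?_
  filter_upwards [Ioo_mem_nhds h0.1 h0.2] with s hs
  refine setIntegral_congr_fun hC.measurableSet fun x hx => ?_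
  simp only [energyDensity_eq, hG, hpd s hs x (hCU hx), hd, hΨ]

end FirstVariation

/-! ### Orthogonal frames of Minkowski four-space -/

/-- Pairing a vanishing combination with `c` and `d` kills their coefficients, and the nonzero Gram
determinant of `a`, `b` kills the other two. Four independent vectors span. -/
theorem exists_frame_coeff {a b c d : E13} (hac : mink a c = 0) (hbc : mink b c = 0)
    (had : mink a d = 0) (hbd : mink b d = 0) (hcd : mink c d = 0) (hc : mink c c ≠ 0)
    (hd : mink d d ≠ 0) (hdet : mink a a * mink b b - mink a b * mink a b ≠ 0) (u : E13) :
    ∃ p q r s : ℝ, u = p • a + q • b + r • c + s • d := by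
  have hli : LinearIndependent ℝ ![a, b, c, d] := by
    rw [Fintype.linearIndependent_iff]
    intro k hk
    simp only [Fin.sum_univ_four, Matrix.cons_val] at hk
    have e : ∀ z, k 0 * mink a z + k 1 * mink b z + k 2 * mink c z + k 3 * mink d z = 0 := by
      intro z
      rw [← mink_smul_left, ← mink_smul_left, ← mink_smul_left, ← mink_smul_left,
        ← mink_add_left, ← mink_add_left, ← mink_add_left, hk]
      simp [mink]
    have e1 := e a
    have e2 := e b
    have e3 := e c
    have e4 := e d
    rw [mink_comm b a, mink_comm c a, mink_comm d a, hac, had] at e1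
    rw [mink_comm c b, mink_comm d b, hbc, hbd] at e2
    rw [hac, hbc, mink_comm d c, hcd] at e3
    rw [had, hbd, hcd] at e4
    have k2 : k 2 = 0 := by simpa [hc] using e3
    have k3 : k 3 = 0 := by simpa [hd] using e4
    have k0 : k 0 = 0 := by
      have : k 0 * (mink a a * mink b b - mink a b * mink a b) = 0 := by
        linear_combination mink b b * e1 - mink a b * e2
      simpa [hdet] using this
    have k1 : k 1 = 0 := by
      have : k 1 * (mink a a * mink b b - mink a b * mink a b) = 0 := by
        linear_combination mink a a * e2 - mink a b * e1
      simpa [hdet] using this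
    intro i
    fin_cases i <;> assumption
  have hspan := hli.span_eq_top_of_card_eq_finrank (by simp)
  have hu : u ∈ Submodule.span ℝ (Set.range ![a, b, c, d]) := by rw [hspan]; trivial
  obtain ⟨k, hk⟩ := (Submodule.mem_span_range_iff_exists_fun ℝ).1 hu
  refine ⟨k 0, k 1, k 2, k 3, ?_⟩
  rw [← hk]; simp [Fin.sum_univ_four]

/-- The scalar product of two vectors in terms of their products with an orthogonal frame. -/
theorem mink_expand {a b c d : E13} (hac : mink a c = 0) (hbc : mink b c = 0)
    (had : mink a d = 0) (hbd : mink b d = 0) (hcd : mink c d = 0) (hc : mink c c ≠ 0)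
    (hd : mink d d ≠ 0) (hdet : mink a a * mink b b - mink a b * mink a b ≠ 0) (u w : E13) :
    (mink a a * mink b b - mink a b * mink a b) * mink u w
      = mink b b * mink u a * mink w a - mink a b * (mink u a * mink w b + mink u b * mink w a)
        + mink a a * mink u b * mink w b
        + (mink a a * mink b b - mink a b * mink a b)
          * (mink u c * mink w c / mink c c + mink u d * mink w d / mink d d) := by
  obtain ⟨p, q, r, s, rfl⟩ := exists_frame_coeff hac hbc had hbd hcd hc hd hdet u
  obtain ⟨p', q', r', s', rfl⟩ := exists_frame_coeff hac hbc had hbd hcd hc hd hdet w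
  simp only [mink_add_left, mink_add_right, mink_smul_left, mink_smul_right, mink_comm b a,
    mink_comm c a, mink_comm d a, mink_comm c b, mink_comm d b, mink_comm d c, hac, hbc, had, hbd,
    hcd]
  field_simp
  ring

/-! ### Hypersurface pieces in coordinates -/

/-- A map `f` with normal field `n` on a coordinate domain, with `⟨f, f⟩` and `⟨n, n⟩`
constant. The conditions are symmetric in `f` and `n`, up to nondegeneracy. -/
structure Adapted (U : Set Plane) (ε δ : ℝ) (f n : Plane → E13) : Prop where
  isOpen : IsOpen U
  smooth : ContDiffOn ℝ ∞ f U
  smooth_normal : ContDiffOn ℝ ∞ n U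
  ne : ε ≠ 0
  ne' : δ ≠ 0
  norm : ∀ x ∈ U, mink (f x) (f x) = ε
  norm' : ∀ x ∈ U, mink (n x) (n x) = δ
  orth : ∀ x ∈ U, mink (f x) (n x) = 0
  tangent : ∀ x ∈ U, ∀ i, mink (pd i f x) (n x) = 0
  det : ∀ x ∈ U, (firstForm f x).det ≠ 0

/-- The case of a definite second fundamental form. -/
structure Definite (U : Set Plane) (ε δ : ℝ) (f n : Plane → E13) : Prop
    extends Adapted U ε δ f n where
  det_pos : ∀ x ∈ U, 0 < (secondForm f n x).det

namespace Adapted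

variable {U : Set Plane} {ε δ : ℝ} {f n : Plane → E13} (A : Adapted U ε δ f n) {x : Plane}
  (hx : x ∈ U)

theorem det_firstForm (f : Plane → E13) (x : Plane) : (firstForm f x).det
    = mink (pd 0 f x) (pd 0 f x) * mink (pd 1 f x) (pd 1 f x)
      - mink (pd 0 f x) (pd 1 f x) * mink (pd 0 f x) (pd 1 f x) := by
  rw [Matrix.det_fin_two]
  simp [firstForm, mink_comm (pd 1 f x) (pd 0 f x)]

include A

theorem smooth_pd (i : Fin 2) : ContDiffOn ℝ ∞ (pd i f) U := contDiffOn_pd A.isOpen A.smooth i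

theorem smooth_pd_normal (i : Fin 2) : ContDiffOn ℝ ∞ (pd i n) U :=
  contDiffOn_pd A.isOpen A.smooth_normal i

include hx

theorem diff : DifferentiableAt ℝ f x := diffAt_of_contDiffOn A.isOpen A.smooth hx

theorem diff_normal : DifferentiableAt ℝ n x := diffAt_of_contDiffOn A.isOpen A.smooth_normal hx

theorem diff_pd (i : Fin 2) : DifferentiableAt ℝ (pd i f) x :=
  diffAt_of_contDiffOn A.isOpen (A.smooth_pd i) hx

theorem diff_pd_normal (i : Fin 2) : DifferentiableAt ℝ (pd i n) x :=
  diffAt_of_contDiffOn A.isOpen (A.smooth_pd_normal i) hx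

theorem diff_pd_pd (i j : Fin 2) : DifferentiableAt ℝ (pd i (pd j f)) x :=
  diffAt_of_contDiffOn A.isOpen (contDiffOn_pd A.isOpen (A.smooth_pd j) i) hx

theorem pd_pd_comm (i j : Fin 2) : pd i (pd j f) x = pd j (pd i f) x :=
  pd_comm A.isOpen A.smooth hx i j

theorem pd_orth (i : Fin 2) : mink (pd i f x) (f x) = 0 := by
  have h := pd_congr A.isOpen A.norm hx i
  rw [pd_mink (A.diff hx) (A.diff hx), pd_const, mink_comm (f x)] at h
  linarith

theorem orth_pd_normal (i : Fin 2) : mink (f x) (pd i n x) = 0 := by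
  have h := pd_congr A.isOpen A.orth hx i
  rw [pd_mink (A.diff hx) (A.diff_normal hx), pd_const, A.tangent x hx] at h
  linarith

theorem normal_pd_normal (i : Fin 2) : mink (pd i n x) (n x) = 0 := by
  have h := pd_congr A.isOpen A.norm' hx i
  rw [pd_mink (A.diff_normal hx) (A.diff_normal hx), pd_const, mink_comm (n x)] at h
  linarith

theorem pd_pd_orth (i j : Fin 2) : mink (pd i (pd j f) x) (f x) = -mink (pd i f x) (pd j f x) := by
  have h := pd_congr A.isOpen (fun y hy => A.pd_orth hy j) hx i
  rw [pd_mink (A.diff_pd hx j) (A.diff hx), pd_const] at h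
  rw [mink_comm (pd i f x)]; linarith

theorem pd_pd_normal (i j : Fin 2) :
    mink (pd i (pd j f) x) (n x) = -mink (pd j f x) (pd i n x) := by
  have h := pd_congr A.isOpen (fun y hy => A.tangent y hy j) hx i
  rw [pd_mink (A.diff_pd hx j) (A.diff_normal hx), pd_const] at h
  linarith

/-- The content is the order of the indices: II is symmetric because second derivatives of `f`
commute. -/
theorem mink_pd_pd_normal (i j : Fin 2) : mink (pd j f x) (pd i n x) = -secondForm f n x i j := by
  have h1 := A.pd_pd_normal hx i j
  have h2 := A.pd_pd_normal hx j i
  rw [A.pd_pd_comm hx] at h1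
  simp only [secondForm, Matrix.of_apply]
  linarith

theorem secondForm_eq (i j : Fin 2) : secondForm f n x i j = mink (pd i (pd j f) x) (n x) := by
  rw [A.pd_pd_normal hx, A.mink_pd_pd_normal hx]; ring

theorem secondForm_symm (i j : Fin 2) : secondForm f n x i j = secondForm f n x j i := by
  rw [A.secondForm_eq hx, A.secondForm_eq hx, A.pd_pd_comm hx]

theorem det_secondForm : (secondForm f n x).det
    = secondForm f n x 0 0 * secondForm f n x 1 1
      - secondForm f n x 0 1 * secondForm f n x 0 1 := by
  rw [Matrix.det_fin_two, A.secondForm_symm hx 1 0]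

/-- The expansion of scalar products in the frame of the surface. -/
theorem expand (u w : E13) :
    (firstForm f x).det * mink u w
      = mink (pd 1 f x) (pd 1 f x) * mink u (pd 0 f x) * mink w (pd 0 f x)
        - mink (pd 0 f x) (pd 1 f x)
          * (mink u (pd 0 f x) * mink w (pd 1 f x) + mink u (pd 1 f x) * mink w (pd 0 f x))
        + mink (pd 0 f x) (pd 0 f x) * mink u (pd 1 f x) * mink w (pd 1 f x)
        + (firstForm f x).det
          * (mink u (n x) * mink w (n x) / δ + mink u (f x) * mink w (f x) / ε) := by
  have hd := A.det x hx
  rw [det_firstForm] at hd ⊢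
  rw [← A.norm x hx, ← A.norm' x hx]
  exact mink_expand (A.tangent x hx 0) (A.tangent x hx 1) (A.pd_orth hx 0) (A.pd_orth hx 1)
    (by rw [mink_comm, A.orth x hx]) (by rw [A.norm' x hx]; exact A.ne')
    (by rw [A.norm x hx]; exact A.ne) hd u w

/-- Expand `u` in the frame of tangent vectors, `n` and `f`. The tangential coefficients solve a
homogeneous system whose determinant is that of I. -/
theorem eq_of_tangent_zero {u : E13} (hu : ∀ i, mink u (pd i f x) = 0) :
    u = (mink u (n x) / δ) • n x + (mink u (f x) / ε) • f x := by
  have hd := A.det x hx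
  rw [det_firstForm] at hd
  have hne := A.ne
  have hne' := A.ne'
  obtain ⟨p, q, r, s, hk⟩ := exists_frame_coeff (A.tangent x hx 0) (A.tangent x hx 1)
    (A.pd_orth hx 0) (A.pd_orth hx 1)
    (by rw [mink_comm, A.orth x hx]) (by rw [A.norm' x hx]; exact A.ne')
    (by rw [A.norm x hx]; exact A.ne) hd u
  have h : ∀ z, mink u z = p * mink (pd 0 f x) z + q * mink (pd 1 f x) z + r * mink (n x) z
      + s * mink (f x) z := by
    intro z
    rw [hk]; simp only [mink_add_left, mink_smul_left]
  have h0 := h (pd 0 f x)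
  have h1 := h (pd 1 f x)
  have h2 := h (n x)
  have h3 := h (f x)
  rw [hu, mink_comm (n x), mink_comm (f x), A.tangent x hx, A.pd_orth hx,
    mink_comm (pd 1 f x) (pd 0 f x)] at h0
  rw [hu, mink_comm (n x), mink_comm (f x), A.tangent x hx, A.pd_orth hx] at h1
  rw [A.tangent x hx, A.tangent x hx, A.norm' x hx, A.orth x hx] at h2
  rw [A.pd_orth hx, A.pd_orth hx, mink_comm (n x), A.norm x hx, A.orth x hx] at h3
  have hp : p = 0 := by
    have : p * (mink (pd 0 f x) (pd 0 f x) * mink (pd 1 f x) (pd 1 f x)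
      - mink (pd 0 f x) (pd 1 f x) * mink (pd 0 f x) (pd 1 f x)) = 0 := by
      linear_combination mink (pd 0 f x) (pd 1 f x) * h1 - mink (pd 1 f x) (pd 1 f x) * h0
    simpa [hd] using this
  have hq : q = 0 := by
    have : q * (mink (pd 0 f x) (pd 0 f x) * mink (pd 1 f x) (pd 1 f x)
      - mink (pd 0 f x) (pd 1 f x) * mink (pd 0 f x) (pd 1 f x)) = 0 := by
      linear_combination mink (pd 0 f x) (pd 1 f x) * h0 - mink (pd 0 f x) (pd 0 f x) * h1
    simpa [hd] using this
  have hr : mink u (n x) / δ = r := by rw [h2]; field_simp; ring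
  have hs : mink u (f x) / ε = s := by rw [h3]; field_simp; ring
  rw [hr, hs]
  simpa [hp, hq] using hk

/-- The determinant of the third fundamental form. -/
theorem det_thirdForm :
    (firstForm f x).det * (firstForm n x).det = (secondForm f n x).det ^ 2 := by
  have hd := A.det x hx
  -- This is III = II I⁻¹ II with the determinant of I cleared, since the derivatives of `n` are
  -- tangent to the surface.
  have key : ∀ i j, (firstForm f x).det * mink (pd i n x) (pd j n x)
      = mink (pd 1 f x) (pd 1 f x) * secondForm f n x i 0 * secondForm f n x j 0
        - mink (pd 0 f x) (pd 1 f x)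
          * (secondForm f n x i 0 * secondForm f n x j 1
            + secondForm f n x i 1 * secondForm f n x j 0)
        + mink (pd 0 f x) (pd 0 f x) * secondForm f n x i 1 * secondForm f n x j 1 := by
    intro i j
    rw [A.expand hx]
    simp only [mink_comm (pd _ n x) (pd _ f x), A.mink_pd_pd_normal hx, A.normal_pd_normal hx,
      mink_comm (pd _ n x) (f x), A.orth_pd_normal hx]
    ring
  have h00 := key 0 0
  have h01 := key 0 1
  have h11 := key 1 1
  rw [A.det_secondForm hx, det_firstForm n]
  rw [A.secondForm_symm hx 1 0] at h01 h11
  apply mul_left_cancel₀ hd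
  set G := (firstForm f x).det with hG
  calc G * (G * (mink (pd 0 n x) (pd 0 n x) * mink (pd 1 n x) (pd 1 n x)
        - mink (pd 0 n x) (pd 1 n x) * mink (pd 0 n x) (pd 1 n x)))
      = (G * mink (pd 0 n x) (pd 0 n x)) * (G * mink (pd 1 n x) (pd 1 n x))
        - (G * mink (pd 0 n x) (pd 1 n x)) * (G * mink (pd 0 n x) (pd 1 n x)) := by ring
    _ = _ := by rw [h00, h01, h11, hG, det_firstForm]; ring

omit hx in
theorem secondForm_swap : ∀ y ∈ U, secondForm n f y = secondForm f n y := by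
  intro y hy
  ext i j
  rw [A.secondForm_symm hy]
  simp only [secondForm, Matrix.of_apply]
  rw [mink_comm]

end Adapted

/-- Interchanging `f` and `n`. -/
theorem Definite.swap {U : Set Plane} {ε δ : ℝ} {f n : Plane → E13} (A : Definite U ε δ f n) :
    Definite U δ ε n f where
  isOpen := A.isOpen
  smooth := A.smooth_normal
  smooth_normal := A.smooth
  ne := A.ne'
  ne' := A.ne
  norm := A.norm'
  norm' := A.norm
  orth y hy := by rw [mink_comm, A.orth y hy]
  tangent y hy i := by rw [mink_comm, A.orth_pd_normal hy]
  det y hy h := by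
    have h1 := A.det_thirdForm hy
    rw [h, mul_zero] at h1
    exact absurd h1.symm (pow_ne_zero 2 (A.det_pos y hy).ne')
  det_pos y hy := by rw [A.secondForm_swap y hy]; exact A.det_pos y hy

theorem inv_fin_two (g : Matrix (Fin 2) (Fin 2) ℝ) :
    g⁻¹ = !![g 1 1 / g.det, -g 0 1 / g.det; -g 1 0 / g.det, g 0 0 / g.det] := by
  rw [Matrix.inv_def, Matrix.adjugate_fin_two, Ring.inverse_eq_inv']
  ext i j
  fin_cases i <;> fin_cases j <;> simp [div_eq_inv_mul]

/-! ### Christoffel symbols and the equations of Gauss and Codazzi. -/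

namespace Adapted

variable {U : Set Plane} {ε δ : ℝ} {f n : Plane → E13} (A : Adapted U ε δ f n) {x : Plane}
  (hx : x ∈ U)

include A

theorem smooth_firstForm (i j : Fin 2) : ContDiffOn ℝ ∞ (fun y => firstForm f y i j) U :=
  contDiffOn_mink (A.smooth_pd i) (A.smooth_pd j)

theorem smooth_secondForm (i j : Fin 2) : ContDiffOn ℝ ∞ (fun y => secondForm f n y i j) U :=
  (contDiffOn_mink (A.smooth_pd i) (A.smooth_pd_normal j)).neg

theorem smooth_det_firstForm : ContDiffOn ℝ ∞ (fun y => (firstForm f y).det) U := by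
  simp only [Matrix.det_fin_two]
  exact ((A.smooth_firstForm 0 0).mul (A.smooth_firstForm 1 1)).sub
    ((A.smooth_firstForm 0 1).mul (A.smooth_firstForm 1 0))

theorem smooth_det_secondForm : ContDiffOn ℝ ∞ (fun y => (secondForm f n y).det) U := by
  simp only [Matrix.det_fin_two]
  exact ((A.smooth_secondForm 0 0).mul (A.smooth_secondForm 1 1)).sub
    ((A.smooth_secondForm 0 1).mul (A.smooth_secondForm 1 0))

include hx

theorem pd_firstForm (k i j : Fin 2) : pd k (fun y => firstForm f y i j) x
    = mink (pd k (pd i f) x) (pd j f x) + mink (pd k (pd j f) x) (pd i f x) := by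
  change pd k (fun y => mink (pd i f y) (pd j f y)) x = _
  rw [pd_mink (A.diff_pd hx i) (A.diff_pd hx j), mink_comm (pd i f x)]

omit A hx in
theorem firstForm_symm (f : Plane → E13) (x : Plane) :
    firstForm f x 1 0 = firstForm f x 0 1 := mink_comm _ _

-- Expanding the derivatives of I in the Koszul formula, all terms cancel in pairs except two equal
-- ones, because second derivatives commute.
omit hx in
theorem christoffel_eq (k i j : Fin 2) : ∀ y ∈ U, christoffel (firstForm f) k i j y
    = ∑ l, (firstForm f y)⁻¹ k l * mink (pd i (pd j f) y) (pd l f y) := by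
  intro y hy
  rw [christoffel, Finset.mul_sum]
  refine Finset.sum_congr rfl fun l _ => ?_
  rw [A.pd_firstForm hy, A.pd_firstForm hy, A.pd_firstForm hy, A.pd_pd_comm hy j i,
    A.pd_pd_comm hy j l, A.pd_pd_comm hy i l]
  ring

omit hx in
theorem firstForm_christoffel (p i j : Fin 2) : ∀ y ∈ U,
    firstForm f y p 0 * christoffel (firstForm f) 0 i j y
      + firstForm f y p 1 * christoffel (firstForm f) 1 i j y
      = mink (pd i (pd j f) y) (pd p f y) := by
  intro y hy
  have hd := A.det y hy
  rw [A.christoffel_eq 0 i j y hy, A.christoffel_eq 1 i j y hy]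
  simp only [inv_fin_two, Fin.sum_univ_two, Matrix.of_apply, Matrix.cons_val', Matrix.cons_val_zero,
    Matrix.cons_val_one, Matrix.cons_val_fin_one]
  field_simp
  rw [Matrix.det_fin_two]
  fin_cases p <;> simp <;> ring

theorem diff_christoffel (k i j : Fin 2) :
    DifferentiableAt ℝ (christoffel (firstForm f) k i j) x := by
  have h : ContDiffOn ℝ ∞ (fun y => ∑ l, (firstForm f y)⁻¹ k l
      * mink (pd i (pd j f) y) (pd l f y)) U := by
    refine ContDiffOn.sum fun l _ => ContDiffOn.mul ?_
      (contDiffOn_mink (contDiffOn_pd A.isOpen (A.smooth_pd j) i) (A.smooth_pd l))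
    simp only [inv_fin_two]
    fin_cases k <;> fin_cases l <;>
      simp only [Matrix.of_apply, Matrix.cons_val', Matrix.cons_val_zero, Fin.zero_eta, Fin.mk_one,
        Matrix.cons_val_one, Matrix.cons_val_fin_one]
    exacts [(A.smooth_firstForm _ _).div A.smooth_det_firstForm A.det,
      (A.smooth_firstForm _ _).neg.div A.smooth_det_firstForm A.det,
      (A.smooth_firstForm _ _).neg.div A.smooth_det_firstForm A.det,
      (A.smooth_firstForm _ _).div A.smooth_det_firstForm A.det]
  exact diffAt_of_contDiffOn A.isOpen (h.congr (A.christoffel_eq k i j)) hx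

/-- The Gauss formula: ∂ᵢ∂ⱼf has Christoffel symbols as tangential coefficients, and components
along `n` and `f` given by II and I. -/
theorem mink_pd_pd (i j m p : Fin 2) : mink (pd i (pd j f) x) (pd m (pd p f) x)
    = christoffel (firstForm f) 0 i j x * mink (pd m (pd p f) x) (pd 0 f x)
      + christoffel (firstForm f) 1 i j x * mink (pd m (pd p f) x) (pd 1 f x)
      + secondForm f n x i j * secondForm f n x m p / δ
      + firstForm f x i j * firstForm f x m p / ε := by
  have hd := A.det x hx
  have h := A.expand hx (pd i (pd j f) x) (pd m (pd p f) x)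
  rw [← A.secondForm_eq hx, ← A.secondForm_eq hx, A.pd_pd_orth hx, A.pd_pd_orth hx] at h
  rw [A.christoffel_eq 0 i j x hx, A.christoffel_eq 1 i j x hx]
  apply mul_left_cancel₀ hd
  rw [h]
  simp only [inv_fin_two, Fin.sum_univ_two, Matrix.of_apply, Matrix.cons_val', Matrix.cons_val_zero,
    Matrix.cons_val_one, Matrix.cons_val_fin_one]
  have hne := A.ne
  have hne' := A.ne'
  field_simp
  rw [det_firstForm]
  simp only [firstForm, Matrix.of_apply, mink_comm (pd 1 f x) (pd 0 f x)]
  ring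

/-- Obtained by differentiating `firstForm_christoffel`. The third derivatives of `f` on the right
drop out on antisymmetrizing in `m` and `i`, which leaves the Gauss equation. -/
theorem gauss_component (m i j p : Fin 2) :
    ∑ l, firstForm f x p l * (pd m (christoffel (firstForm f) l i j) x
      + ∑ k, christoffel (firstForm f) l m k x * christoffel (firstForm f) k i j x)
    = mink (pd m (pd i (pd j f)) x) (pd p f x)
      + secondForm f n x i j * secondForm f n x m p / δ
      + firstForm f x i j * firstForm f x m p / ε := by
  have h := pd_congr A.isOpen (A.firstForm_christoffel p i j) hx m
  have dg : ∀ l, DifferentiableAt ℝ (fun y => firstForm f y p l) x := fun l =>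
    diffAt_of_contDiffOn A.isOpen (A.smooth_firstForm p l) hx
  have dc : ∀ l, DifferentiableAt ℝ (christoffel (firstForm f) l i j) x := fun l =>
    A.diff_christoffel hx l i j
  rw [pd_add ((dg 0).fun_mul (dc 0)) ((dg 1).fun_mul (dc 1)), pd_mul (dg 0) (dc 0), pd_mul (dg 1) (dc 1),
    A.pd_firstForm hx, A.pd_firstForm hx, pd_mink (A.diff_pd_pd hx i j) (A.diff_pd hx p),
    A.mink_pd_pd hx] at h
  have h0 := A.firstForm_christoffel p m 0 x hx
  have h1 := A.firstForm_christoffel p m 1 x hx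
  simp only [Fin.sum_univ_two]
  linear_combination h + christoffel (firstForm f) 0 i j x * h0
    + christoffel (firstForm f) 1 i j x * h1

/-- The Gauss equation. -/
theorem curvature_eq (hε : ε = -1) (hδ : δ = 1) :
    curvature (firstForm f) x = -1 + (secondForm f n x).det / (firstForm f x).det := by
  have hd := A.det x hx
  have h1 := A.gauss_component hx 0 1 1 0
  have h2 := A.gauss_component hx 1 0 1 0
  -- The third derivatives in `h1` and `h2` agree, so only the products of the fundamental forms
  -- survive in the difference.
  have h3 : pd 1 (pd 0 (pd 1 f)) x = pd 0 (pd 1 (pd 1 f)) x :=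
    pd_comm A.isOpen (A.smooth_pd 1) hx 1 0
  rw [h3] at h2
  rw [curvature, div_eq_iff hd, add_mul, div_mul_cancel₀ _ hd, A.det_secondForm hx]
  simp only [riemann, Fin.sum_univ_two] at h1 h2 ⊢
  rw [Matrix.det_fin_two, firstForm_symm]
  rw [hε, hδ] at h1 h2
  rw [firstForm_symm, A.secondForm_symm hx 1 0] at h2
  linear_combination h1 - h2

/-- The Codazzi equations. -/
theorem codazzi (k i j : Fin 2) : pd k (fun y => secondForm f n y i j) x
      - pd i (fun y => secondForm f n y k j) x
    = mink (pd i (pd j f) x) (pd k n x) - mink (pd k (pd j f) x) (pd i n x) := by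
  have h : ∀ k i, pd k (fun y => secondForm f n y i j) x
      = mink (pd k (pd i (pd j f)) x) (n x) + mink (pd i (pd j f) x) (pd k n x) := by
    intro k i
    rw [pd_congr A.isOpen (fun y hy => A.secondForm_eq hy i j) hx,
      pd_mink (A.diff_pd_pd hx i j) (A.diff_normal hx)]
  rw [h, h, pd_comm A.isOpen (A.smooth_pd j) hx k i]
  ring

end Adapted

/-! ### The Laplacian of the second fundamental form and the tangential part of Δf. -/

namespace Definite

variable {U : Set Plane} {ε δ : ℝ} {f n : Plane → E13} (A : Definite U ε δ f n) {x : Plane}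
  (hx : x ∈ U)

/-- The densitized inverse of the second fundamental form. -/
noncomputable abbrev dens (f n : Plane → E13) (x : Plane) : Matrix (Fin 2) (Fin 2) ℝ :=
  invDensity (secondForm f n x)

include A

theorem dens_apply : ∀ y ∈ U, dens f n y = (Real.sqrt (secondForm f n y).det)⁻¹ •
    !![secondForm f n y 1 1, -secondForm f n y 0 1;
      -secondForm f n y 0 1, secondForm f n y 0 0] := by
  intro y hy
  have hd := A.det_pos y hy
  have hs := Real.sqrt_pos.2 hd
  have hsq := Real.mul_self_sqrt hd.le
  have key : ∀ a, Real.sqrt (secondForm f n y).det * (a / (secondForm f n y).det)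
      = (Real.sqrt (secondForm f n y).det)⁻¹ * a := by
    intro a
    nth_rw 2 [← hsq]
    field_simp
  rw [dens, invDensity, inv_fin_two, A.secondForm_symm hy 1 0]
  ext i j
  fin_cases i <;> fin_cases j <;> simp [key, neg_div]

theorem dens_symm : ∀ y ∈ U, dens f n y 1 0 = dens f n y 0 1 := by
  intro y hy
  rw [A.dens_apply y hy]; simp

theorem smooth_sqrt : ContDiffOn ℝ ∞ (fun y => (Real.sqrt (secondForm f n y).det)⁻¹) U :=
  (A.smooth_det_secondForm.sqrt fun y hy => (A.det_pos y hy).ne').inv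
    fun y hy => (Real.sqrt_pos.2 (A.det_pos y hy)).ne'

theorem smooth_dens (i j : Fin 2) : ContDiffOn ℝ ∞ (fun y => dens f n y i j) U := by
  refine ContDiffOn.congr (f := fun y => (Real.sqrt (secondForm f n y).det)⁻¹ *
    !![secondForm f n y 1 1, -secondForm f n y 0 1;
      -secondForm f n y 0 1, secondForm f n y 0 0] i j) (A.smooth_sqrt.mul ?_) fun y hy => by
    rw [A.dens_apply y hy]; rfl
  fin_cases i <;> fin_cases j <;> simp
  exacts [A.smooth_secondForm _ _, (A.smooth_secondForm _ _).neg, (A.smooth_secondForm _ _).neg,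
    A.smooth_secondForm _ _]

/-- The quotient of the determinants of the second and the first fundamental form. -/
noncomputable def _root_.HypSurf.detRatio (f n : Plane → E13) (x : Plane) : ℝ :=
  (secondForm f n x).det / (firstForm f x).det

theorem smooth_detRatio : ContDiffOn ℝ ∞ (detRatio f n) U :=
  A.smooth_det_secondForm.div A.smooth_det_firstForm A.det

include hx

theorem divGrad_eq {V : Type*} [NormedAddCommGroup V] [NormedSpace ℝ V] {φ : Plane → V}
    (hφ : ContDiffOn ℝ ∞ φ U) : divGrad (dens f n) φ x
      = ∑ i, ∑ j, (pd i (fun y => dens f n y i j) x • pd j φ x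
        + dens f n x i j • pd i (pd j φ) x) := by
  rw [divGrad]
  refine Finset.sum_congr rfl fun i _ => ?_
  have hd : ∀ j, DifferentiableAt ℝ (fun y => dens f n y i j) x := fun j =>
    diffAt_of_contDiffOn A.isOpen (A.smooth_dens i j) hx
  have hp : ∀ j, DifferentiableAt ℝ (pd j φ) x := fun j =>
    diffAt_of_contDiffOn A.isOpen (contDiffOn_pd A.isOpen hφ j) hx
  rw [pd_sum _ fun j _ => (hd j).fun_smul (hp j)]
  exact Finset.sum_congr rfl fun j _ => pd_smul (hd j) (hp j) i

theorem mink_divGrad (z : E13) : mink (divGrad (dens f n) f x) z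
      = ∑ i, ∑ j, (pd i (fun y => dens f n y i j) x * mink (pd j f x) z
        + dens f n x i j * mink (pd i (pd j f) x) z) := by
  rw [A.divGrad_eq hx A.smooth]
  simp only [Fin.sum_univ_two, mink_add_left, mink_smul_left]

theorem mink_divGrad_normal : mink (divGrad (dens f n) f x) (n x)
    = ∑ i, ∑ j, dens f n x i j * secondForm f n x i j := by
  rw [A.mink_divGrad hx]
  refine Finset.sum_congr rfl fun i _ => Finset.sum_congr rfl fun j _ => ?_
  rw [A.tangent x hx, A.secondForm_eq hx, mul_zero, zero_add]

/-- The tangential part of the Laplacian of `f` with respect to the second fundamental form is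
minus half the gradient of the logarithm of `detRatio`. -/
theorem mink_divGrad_pd (k : Fin 2) :
    2 * detRatio f n x * mink (divGrad (dens f n) f x) (pd k f x)
      = -∑ j, ∑ l, dens f n x j l * firstForm f x j k * pd l (detRatio f n) x := by
  have hd := A.det x hx
  have hH := A.det_pos x hx
  set r : Plane → ℝ := fun y => (Real.sqrt (secondForm f n y).det)⁻¹ with hr
  have hr0 : r x ≠ 0 := inv_ne_zero (Real.sqrt_pos.2 hH).ne'
  have dr : DifferentiableAt ℝ r x := diffAt_of_contDiffOn A.isOpen A.smooth_sqrt hx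
  have dh : ∀ i j, DifferentiableAt ℝ (fun y => secondForm f n y i j) x := fun i j =>
    diffAt_of_contDiffOn A.isOpen (A.smooth_secondForm i j) hx
  have dg : ∀ i j, DifferentiableAt ℝ (fun y => firstForm f y i j) x := fun i j =>
    diffAt_of_contDiffOn A.isOpen (A.smooth_firstForm i j) hx
  have dH := diffAt_of_contDiffOn A.isOpen A.smooth_det_secondForm hx
  have dG := diffAt_of_contDiffOn A.isOpen A.smooth_det_firstForm hx
  have dD := diffAt_of_contDiffOn A.isOpen A.smooth_detRatio hx
  -- Differentiating this relation gives the derivative of `r` without differentiating a square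
  -- root.
  have hrH : ∀ y ∈ U, r y * r y * (secondForm f n y).det = 1 := by
    intro y hy
    have h1 := Real.sqrt_pos.2 (A.det_pos y hy)
    have h2 := Real.mul_self_sqrt (A.det_pos y hy).le
    simp only [hr]
    nth_rw 3 [← h2]
    field_simp
  have er : ∀ l, 2 * pd l r x * (secondForm f n x).det
      + r x * pd l (fun y => (secondForm f n y).det) x = 0 := by
    intro l
    have h := pd_congr A.isOpen hrH hx l
    rw [pd_mul (dr.fun_mul dr) dH, pd_mul dr dr, pd_const] at h
    apply mul_left_cancel₀ hr0
    linear_combination h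
  have eD : ∀ l, pd l (detRatio f n) x * (firstForm f x).det
      + detRatio f n x * pd l (fun y => (firstForm f y).det) x
      = pd l (fun y => (secondForm f n y).det) x := by
    intro l
    rw [← pd_mul dD dG]
    exact pd_congr A.isOpen (fun y hy => div_mul_cancel₀ _ (A.det y hy)) hx l
  have eG : ∀ l, pd l (fun y => (firstForm f y).det) x
      = 2 * (mink (pd l (pd 0 f) x) (pd 0 f x) * firstForm f x 1 1
        + mink (pd l (pd 1 f) x) (pd 1 f x) * firstForm f x 0 0
        - (mink (pd l (pd 0 f) x) (pd 1 f x) + mink (pd l (pd 1 f) x) (pd 0 f x))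
          * firstForm f x 0 1) := by
    intro l
    have : (fun y => (firstForm f y).det) = fun y => firstForm f y 0 0 * firstForm f y 1 1
        - firstForm f y 0 1 * firstForm f y 0 1 := by
      funext y; rw [Matrix.det_fin_two, Adapted.firstForm_symm]
    rw [this, pd_sub ((dg 0 0).fun_mul (dg 1 1)) ((dg 0 1).fun_mul (dg 0 1)),
      pd_mul (dg 0 0) (dg 1 1), pd_mul (dg 0 1) (dg 0 1), A.pd_firstForm hx, A.pd_firstForm hx,
      A.pd_firstForm hx]
    ring
  -- The divergence of the rows of `dens` contains derivatives of II only in these two Codazzi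
  -- combinations, apart from the derivatives of `r`.
  have c1 := A.codazzi hx 0 1 1
  have c2 := A.codazzi hx 1 0 0
  -- The Weingarten equations, used to express the right-hand sides of Codazzi by I, II and
  -- tangential second derivatives.
  have eN : ∀ i j m, (firstForm f x).det * mink (pd i (pd j f) x) (pd m n x)
      = -(firstForm f x 1 1 * mink (pd i (pd j f) x) (pd 0 f x) * secondForm f n x 0 m
        - firstForm f x 0 1 * (mink (pd i (pd j f) x) (pd 0 f x) * secondForm f n x 1 m
            + mink (pd i (pd j f) x) (pd 1 f x) * secondForm f n x 0 m)
        + firstForm f x 0 0 * mink (pd i (pd j f) x) (pd 1 f x) * secondForm f n x 1 m) := by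
    intro i j m
    rw [A.expand hx]
    simp only [mink_comm (pd _ n x) (pd _ f x), A.normal_pd_normal hx,
      mink_comm (pd _ n x) (f x), A.orth_pd_normal hx]
    simp only [A.mink_pd_pd_normal hx, A.secondForm_symm hx m, firstForm, Matrix.of_apply]
    ring
  have hc : pd 1 (pd 0 f) x = pd 0 (pd 1 f) x := A.pd_pd_comm hx 1 0
  have p00 : ∀ i, pd i (fun y => dens f n y 0 0) x
      = pd i r x * secondForm f n x 1 1 + r x * pd i (fun y => secondForm f n y 1 1) x := by
    intro i
    rw [← pd_mul dr (dh 1 1)]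
    exact pd_congr A.isOpen (fun y hy => by rw [A.dens_apply y hy]; simp [hr]) hx i
  have p11 : ∀ i, pd i (fun y => dens f n y 1 1) x
      = pd i r x * secondForm f n x 0 0 + r x * pd i (fun y => secondForm f n y 0 0) x := by
    intro i
    rw [← pd_mul dr (dh 0 0)]
    exact pd_congr A.isOpen (fun y hy => by rw [A.dens_apply y hy]; simp [hr]) hx i
  have p01 : ∀ i, pd i (fun y => dens f n y 0 1) x
      = -(pd i r x * secondForm f n x 0 1 + r x * pd i (fun y => secondForm f n y 0 1) x) := by
    intro i
    rw [← pd_mul dr (dh 0 1), ← pd_neg]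
    exact pd_congr A.isOpen (fun y hy => by rw [A.dens_apply y hy]; simp [hr]) hx i
  have p10 : ∀ i, pd i (fun y => dens f n y 1 0) x
      = -(pd i r x * secondForm f n x 0 1 + r x * pd i (fun y => secondForm f n y 0 1) x) := by
    intro i
    rw [← p01]
    exact pd_congr A.isOpen A.dens_symm hx i
  have q00 : dens f n x 0 0 = r x * secondForm f n x 1 1 := by
    rw [A.dens_apply x hx]; simp [hr]
  have q11 : dens f n x 1 1 = r x * secondForm f n x 0 0 := by
    rw [A.dens_apply x hx]; simp [hr]
  have q01 : dens f n x 0 1 = -(r x * secondForm f n x 0 1) := by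
    rw [A.dens_apply x hx]; simp [hr]
  have q10 : dens f n x 1 0 = -(r x * secondForm f n x 0 1) := by
    rw [A.dens_symm x hx, q01]
  have s10 : pd 0 (fun y => secondForm f n y 1 0) x = pd 0 (fun y => secondForm f n y 0 1) x :=
    pd_congr A.isOpen (fun y hy => A.secondForm_symm hy 1 0) hx 0
  have hDG : detRatio f n x * (firstForm f x).det = (secondForm f n x).det :=
    div_mul_cancel₀ _ hd
  have eDet : (firstForm f x).det = firstForm f x 0 0 * firstForm f x 1 1
      - firstForm f x 0 1 * firstForm f x 0 1 := by rw [Matrix.det_fin_two, Adapted.firstForm_symm]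
  have eN1 := eN 1 1 0
  have eN2 := eN 0 1 1
  have eN3 := eN 0 0 1
  have eN4 := eN 0 1 0
  rw [A.secondForm_symm hx 1 0] at eN1 eN4
  rw [hc] at c2
  rw [A.mink_divGrad hx]
  simp only [Fin.sum_univ_two, p00, p01, p10, p11, q00, q01, q10, q11, hc]
  have er0 := er 0
  have er1 := er 1
  have eD0 := eD 0
  have eD1 := eD 1
  have eG0 := eG 0
  have eG1 := eG 1
  rw [hc] at eG1
  have f0 : ∀ j, mink (pd j f x) (pd k f x) = firstForm f x j k := fun j => rfl
  rw [f0, f0]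
  rw [s10] at c2
  -- Substituting det II = D det I turns the derivative of `r` into one of D and of det I.
  rw [← hDG, ← eD0, eG0] at er0
  rw [← hDG, ← eD1, eG1] at er1
  apply mul_left_cancel₀ hd
  set D := detRatio f n x
  set G := (firstForm f x).det
  have h10 := Adapted.firstForm_symm f x
  -- The weights of `er0` and `er1` are contractions of the adjugate of II with I. The Codazzi terms
  -- are weighted by I and cancel the derivatives of det I.
  obtain rfl | rfl : k = 0 ∨ k = 1 := by fin_cases k <;> simp
  · rw [h10]
    linear_combination
      (secondForm f n x 1 1 * firstForm f x 0 0 - secondForm f n x 0 1 * firstForm f x 0 1) * er0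
      + (secondForm f n x 0 0 * firstForm f x 0 1 - secondForm f n x 0 1 * firstForm f x 0 0) * er1
      + 2 * D * r x * firstForm f x 0 0 * (G * c1 + eN1 - eN2)
      + 2 * D * r x * firstForm f x 0 1 * (G * c2 + eN3 - eN4)
      + 2 * D * r x * (secondForm f n x 1 1 * mink (pd 0 (pd 0 f) x) (pd 0 f x)
        - 2 * secondForm f n x 0 1 * mink (pd 0 (pd 1 f) x) (pd 0 f x)
        + secondForm f n x 0 0 * mink (pd 1 (pd 1 f) x) (pd 0 f x)) * eDet
  · linear_combination
      (secondForm f n x 1 1 * firstForm f x 0 1 - secondForm f n x 0 1 * firstForm f x 1 1) * er0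
      + (secondForm f n x 0 0 * firstForm f x 1 1 - secondForm f n x 0 1 * firstForm f x 0 1) * er1
      + 2 * D * r x * firstForm f x 0 1 * (G * c1 + eN1 - eN2)
      + 2 * D * r x * firstForm f x 1 1 * (G * c2 + eN3 - eN4)
      + 2 * D * r x * (secondForm f n x 1 1 * mink (pd 0 (pd 0 f) x) (pd 1 f x)
        - 2 * secondForm f n x 0 1 * mink (pd 0 (pd 1 f) x) (pd 1 f x)
        + secondForm f n x 0 0 * mink (pd 1 (pd 1 f) x) (pd 1 f x)) * eDet

end Definite

/-! ### Consequences of a stationary determinant ratio, and the symmetry between f and n. -/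

namespace Definite

variable {U : Set Plane} {ε δ : ℝ} {f n : Plane → E13} (A : Definite U ε δ f n) {x : Plane}
  (hx : x ∈ U)

include A

/-- In dimension two the density √(det h) h⁻¹ is unimodular, which is why it depends only on the
conformal class. -/
theorem det_dens : ∀ y ∈ U, dens f n y 0 0 * dens f n y 1 1 - dens f n y 0 1 * dens f n y 0 1
    = 1 := by
  intro y hy
  have h1 := Real.sqrt_pos.2 (A.det_pos y hy)
  have h2 := Real.mul_self_sqrt (A.det_pos y hy).le
  have h3 := A.det_secondForm hy
  rw [A.dens_apply y hy]
  simp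
  field_simp
  nlinarith

theorem detRatio_ne_zero (y : Plane) (hy : y ∈ U) : detRatio f n y ≠ 0 :=
  div_ne_zero (A.det_pos y hy).ne' (A.det y hy)

theorem dens_swap : ∀ y ∈ U, dens n f y = dens f n y := fun y hy => by
  rw [dens, dens, A.secondForm_swap y hy]

/-- A restatement of det I · det III = (det II)². It carries stationarity over from `f` to `n`. -/
theorem detRatio_swap : ∀ y ∈ U, detRatio n f y * detRatio f n y = 1 := by
  intro y hy
  have h1 := A.det_thirdForm hy
  have h2 := A.det y hy
  have h3 := A.swap.det y hy
  have h4 := (A.det_pos y hy).ne'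
  rw [detRatio, detRatio, A.secondForm_swap y hy]
  field_simp
  linarith

include hx

theorem divGrad_dens_swap {V : Type*} [NormedAddCommGroup V] [NormedSpace ℝ V] (φ : Plane → V) :
    divGrad (dens n f) φ x = divGrad (dens f n) φ x := by
  refine Finset.sum_congr rfl fun i _ => pd_congr A.isOpen (fun y hy => ?_) hx i
  simp only [A.dens_swap y hy]

/-- If the tangential part of the Laplacian of `f` vanishes, then `detRatio` is stationary. -/
theorem pd_detRatio_eq_zero (h : ∀ k, mink (divGrad (dens f n) f x) (pd k f x) = 0) (l : Fin 2) :
    pd l (detRatio f n) x = 0 := by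
  have e0 := A.mink_divGrad_pd hx 0
  have e1 := A.mink_divGrad_pd hx 1
  have hd := A.det x hx
  have hP := A.det_dens x hx
  rw [h, mul_zero] at e0 e1
  simp only [Fin.sum_univ_two, A.dens_symm x hx, Adapted.firstForm_symm] at e0 e1
  rw [Matrix.det_fin_two, Adapted.firstForm_symm] at hd
  -- `a` and `b` are the components of the densitized II-gradient of D. Nondegeneracy of I makes
  -- them vanish, and then that of `dens` does the same for the partial derivatives.
  set a := dens f n x 0 0 * pd 0 (detRatio f n) x + dens f n x 0 1 * pd 1 (detRatio f n) x with ha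
  set b := dens f n x 0 1 * pd 0 (detRatio f n) x + dens f n x 1 1 * pd 1 (detRatio f n) x with hb
  have a0 : a = 0 := by
    have : a * (firstForm f x 0 0 * firstForm f x 1 1 - firstForm f x 0 1 * firstForm f x 0 1)
        = 0 := by
      rw [ha]
      linear_combination firstForm f x 1 1 * e0 - firstForm f x 0 1 * e1
    simpa [hd] using this
  have b0 : b = 0 := by
    have : b * (firstForm f x 0 0 * firstForm f x 1 1 - firstForm f x 0 1 * firstForm f x 0 1)
        = 0 := by
      rw [hb]
      linear_combination firstForm f x 0 0 * e1 - firstForm f x 0 1 * e0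
    simpa [hd] using this
  obtain rfl | rfl : l = 0 ∨ l = 1 := by fin_cases l <;> simp
  · linear_combination dens f n x 1 1 * a0 - dens f n x 0 1 * b0
      - pd 0 (detRatio f n) x * hP
  · linear_combination dens f n x 0 0 * b0 - dens f n x 0 1 * a0
      - pd 1 (detRatio f n) x * hP

theorem tangent_divGrad_eq_zero (h : ∀ l, pd l (detRatio f n) x = 0) (k : Fin 2) :
    mink (divGrad (dens f n) f x) (pd k f x) = 0 := by
  have e := A.mink_divGrad_pd hx k
  simp only [h, mul_zero, Finset.sum_const_zero, neg_zero] at e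
  have := A.detRatio_ne_zero x hx
  simpa [this] using e

theorem divGrad_eq_span (h : ∀ l, pd l (detRatio f n) x = 0) :
    divGrad (dens f n) f x = (mink (divGrad (dens f n) f x) (n x) / δ) • n x
      + (mink (divGrad (dens f n) f x) (f x) / ε) • f x :=
  A.eq_of_tangent_zero hx (A.tangent_divGrad_eq_zero hx h)

theorem pd_detRatio_swap (h : ∀ l, pd l (detRatio f n) x = 0) (l : Fin 2) :
    pd l (detRatio n f) x = 0 := by
  have e := pd_congr A.isOpen A.detRatio_swap hx l
  rw [pd_mul (diffAt_of_contDiffOn A.isOpen A.swap.smooth_detRatio hx)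
    (diffAt_of_contDiffOn A.isOpen A.smooth_detRatio hx), pd_const, h, mul_zero, add_zero] at e
  simpa [A.detRatio_ne_zero x hx] using e

theorem divGrad_normal_eq_span (h : ∀ l, pd l (detRatio f n) x = 0) :
    divGrad (dens f n) n x = (mink (divGrad (dens f n) n x) (f x) / ε) • f x
      + (mink (divGrad (dens f n) n x) (n x) / δ) • n x := by
  have e := A.swap.divGrad_eq_span hx (A.pd_detRatio_swap hx h)
  rwa [A.divGrad_dens_swap hx] at e

/-- Both sides are the trace of II with respect to `dens`, since II is unchanged when `f` and `n`
are interchanged. -/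
theorem mink_divGrad_normal_comm :
    mink (divGrad (dens f n) n x) (f x) = mink (divGrad (dens f n) f x) (n x) := by
  rw [A.mink_divGrad_normal hx, ← A.divGrad_dens_swap hx, A.swap.mink_divGrad_normal hx,
    A.dens_swap x hx, A.secondForm_swap x hx]

/-- The mixed term in the Laplacian of `f ∧ n` vanishes. -/
theorem sum_dens_wedge_eq_zero :
    ∑ i, ∑ j, dens f n x i j • wedge (pd i f x) (pd j n x) = 0 := by
  have hd := A.det x hx
  rw [Adapted.det_firstForm] at hd
  -- The coefficients are those of the shape operator, up to sign. The sum is then a multiple of ∂₀f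
  -- ∧ ∂₁f, and the factor vanishes because the shape operator is self-adjoint for I.
  have hw : ∀ j, ∃ p q : ℝ, pd j n x = p • pd 0 f x + q • pd 1 f x := by
    intro j
    obtain ⟨p, q, r, s, hk⟩ := exists_frame_coeff (A.tangent x hx 0) (A.tangent x hx 1)
      (A.pd_orth hx 0) (A.pd_orth hx 1)
      (by rw [mink_comm, A.orth x hx]) (by rw [A.norm' x hx]; exact A.ne')
      (by rw [A.norm x hx]; exact A.ne) hd (pd j n x)
    have h1 := congrArg (fun z => mink z (n x)) hk
    have h2 := congrArg (fun z => mink z (f x)) hk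
    simp only [mink_add_left, mink_smul_left, A.tangent x hx, A.pd_orth hx, A.normal_pd_normal hx,
      A.norm x hx, A.norm' x hx, A.orth x hx, mink_comm (n x) (f x), mink_comm (pd _ n x) (f x),
      A.orth_pd_normal hx, mul_zero, add_zero, zero_add] at h1 h2
    have hr : r = 0 := by simpa [A.ne', eq_comm] using h1
    have hs : s = 0 := by simpa [A.ne, eq_comm] using h2
    exact ⟨p, q, by simpa [hr, hs] using hk⟩
  obtain ⟨p, q, h0⟩ := hw 0
  obtain ⟨p', q', h1⟩ := hw 1
  have m := A.mink_pd_pd_normal hx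
  have m00 := m 0 0
  have m10 := m 0 1
  have m01 := m 1 0
  have m11 := m 1 1
  rw [A.secondForm_symm hx 1 0] at m01
  rw [h0] at m00 m10
  rw [h1] at m01 m11
  simp only [mink_add_right, mink_smul_right, mink_comm (pd 1 f x) (pd 0 f x)] at m00 m01 m10 m11
  simp only [Fin.sum_univ_two, A.dens_symm x hx]
  rw [A.dens_apply x hx, h0, h1]
  ext i j
  simp [wedge]
  generalize (Real.sqrt (secondForm f n x).det)⁻¹ = r
  linear_combination r * (pd 0 f x i * pd 1 f x j - pd 0 f x j * pd 1 f x i)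
    * (q * m11 - p' * m00 + p * m01 - q' * m10)

/-- Leibniz rule; the cross terms add up to twice the sum in `sum_dens_wedge_eq_zero`. -/
theorem divGrad_wedge : divGrad (dens f n) (fun y => wedge (f y) (n y)) x
    = wedge (divGrad (dens f n) f x) (n x) + wedge (f x) (divGrad (dens f n) n x) := by
  have hsm : ContDiffOn ℝ ∞ (fun y => wedge (f y) (n y)) U :=
    (wedgeL.contDiff.comp_contDiffOn A.smooth).clm_apply A.smooth_normal
  have h1 : ∀ j, ∀ y ∈ U, pd j (fun y => wedge (f y) (n y)) y
      = wedge (pd j f y) (n y) + wedge (f y) (pd j n y) := fun j y hy =>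
    pd_bilin wedgeL (A.diff hy) (A.diff_normal hy) j
  have h2 : ∀ i j, pd i (pd j (fun y => wedge (f y) (n y))) x
      = (wedge (pd i (pd j f) x) (n x) + wedge (pd j f x) (pd i n x))
        + (wedge (pd i f x) (pd j n x) + wedge (f x) (pd i (pd j n) x)) := by
    intro i j
    rw [pd_congr A.isOpen (h1 j) hx]
    have d1 : DifferentiableAt ℝ (fun y => wedge (pd j f y) (n y)) x :=
      (wedgeL.differentiableAt.comp x (A.diff_pd hx j)).clm_apply (A.diff_normal hx)
    have d2 : DifferentiableAt ℝ (fun y => wedge (f y) (pd j n y)) x :=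
      (wedgeL.differentiableAt.comp x (A.diff hx)).clm_apply (A.diff_pd_normal hx j)
    rw [pd_add d1 d2]
    exact congrArg₂ (· + ·) (pd_bilin wedgeL (A.diff_pd hx j) (A.diff_normal hx) i)
      (pd_bilin wedgeL (A.diff hx) (A.diff_pd_normal hx j) i)
  have h3 := A.sum_dens_wedge_eq_zero hx
  rw [A.divGrad_eq hx hsm, A.divGrad_eq hx A.smooth, A.divGrad_eq hx A.smooth_normal]
  simp only [h2, h1 _ x hx]
  ext a b
  have h4 := congrFun (congrFun h3 a) b
  simp only [Fin.sum_univ_two, A.dens_symm x hx] at h4 ⊢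
  simp [wedge] at h4 ⊢
  linear_combination 2 * h4

end Definite

/-! ### Critical points of the energy on a coordinate domain -/

/-- `φ` is a critical point of the energy on the coordinate domain `U`. -/
def IsCritical {V : Type*} [NormedAddCommGroup V] [NormedSpace ℝ V] (U : Set Plane)
    (h : Plane → Matrix (Fin 2) (Fin 2) ℝ) (N : Set V) (G : V → V → V → ℝ) (φ : Plane → V) :
    Prop :=
  ∀ C : Set Plane, IsCompact C → C ⊆ U → ∀ ε : ℝ, 0 < ε → ∀ Φ : ℝ → Plane → V,
    ContDiffOn ℝ ∞ (fun q : ℝ × Plane => Φ q.1 q.2) (Ioo (-ε) ε ×ˢ U) →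
    (∀ s ∈ Ioo (-ε) ε, ∀ x ∈ U, Φ s x ∈ N) →
    (∀ x ∈ U, Φ 0 x = φ x) →
    (∀ s ∈ Ioo (-ε) ε, ∀ x ∈ U \ C, Φ s x = φ x) →
    HasDerivAt (fun s => ∫ x in C, energyDensity (h x) G (Φ s) x) 0 0

section Criteria

variable {V : Type*} [NormedAddCommGroup V] [NormedSpace ℝ V] {U : Set Plane} {ε δ : ℝ}
  {f n : Plane → E13} (A : Definite U ε δ f n) (B ℓ : V →L[ℝ] V →L[ℝ] ℝ)
  (hB : ∀ u v, B u v = B v u) (κ : ℝ) {G : V → V → V → ℝ}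
  (hG : ∀ b w w', G b w w' = B w w' - κ * (ℓ b w * ℓ b w'))
  {φ : Plane → V} (hφ : ContDiffOn ℝ ∞ φ U) (hℓ : ∀ x ∈ U, ∀ i, ℓ (φ x) (pd i φ x) = 0)
  {N : Set V}

include A hB hG hφ hℓ

/-- The general first variation formula asks for symmetry of the density at every point of the
plane, so II is replaced by zero outside `U`. -/
theorem Definite.hasDerivAt_energy {C : Set Plane} (hC : IsCompact C) (hCU : C ⊆ U) {η : ℝ}
    (hη : 0 < η) {Φ : ℝ → Plane → V}
    (hΦ : ContDiffOn ℝ ∞ (fun q : ℝ × Plane => Φ q.1 q.2) (Ioo (-η) η ×ˢ U))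
    (hΦ0 : ∀ x ∈ U, Φ 0 x = φ x) (hout : ∀ s ∈ Ioo (-η) η, ∀ x ∈ U \ C, Φ s x = φ x) :
    HasDerivAt (fun s => ∫ x in C, energyDensity (secondForm f n x) G (Φ s) x)
      (-∫ x in C, B (deriv (fun s => Φ s x) 0) (divGrad (Definite.dens f n) φ x)) 0 := by
  classical
  set h : Plane → Matrix (Fin 2) (Fin 2) ℝ := fun x => if x ∈ U then secondForm f n x else 0 with hh
  have hhU : ∀ x ∈ U, h x = secondForm f n x := fun x hx => if_pos hx
  have key := HypSurf.hasDerivAt_energy B ℓ hB κ hG A.isOpen hC hCU hη (h := h)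
    (fun i j => (A.smooth_dens i j).congr fun x hx => by rw [hhU x hx])
    (fun x => by
      by_cases hx : x ∈ U
      · rw [hhU x hx]; exact A.dens_symm x hx
      · simp [hh, hx, invDensity]) hφ hℓ hΦ hΦ0 hout
  have e1 : ∀ s, ∫ x in C, energyDensity (h x) G (Φ s) x
      = ∫ x in C, energyDensity (secondForm f n x) G (Φ s) x := fun s =>
    setIntegral_congr_fun hC.measurableSet fun x hx => by simp only [hhU x (hCU hx)]
  have e2 : ∫ x in C, B (deriv (fun s => Φ s x) 0) (divGrad (fun y => invDensity (h y)) φ x)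
      = ∫ x in C, B (deriv (fun s => Φ s x) 0) (divGrad (Definite.dens f n) φ x) := by
    refine setIntegral_congr_fun hC.measurableSet fun x hx => ?_
    have : divGrad (fun y => invDensity (h y)) φ x = divGrad (Definite.dens f n) φ x :=
      Finset.sum_congr rfl fun i _ =>
        pd_congr A.isOpen (fun y hy => by simp only [hhU y hy]) (hCU hx) i
    simp only [this]
  simpa only [e1, e2] using key

/-- A map is critical if its Laplacian is orthogonal to all velocities of curves in `N`. -/
theorem Definite.isCritical_of_orthogonal
    (horth : ∀ x ∈ U, ∀ η : ℝ, 0 < η → ∀ γ : ℝ → V, DifferentiableAt ℝ γ 0 → γ 0 = φ x →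
      (∀ s ∈ Ioo (-η) η, γ s ∈ N) → B (deriv γ 0) (divGrad (Definite.dens f n) φ x) = 0) :
    IsCritical U (secondForm f n) N G φ := by
  intro C hC hCU η hη Φ hΦ hN hΦ0 hout
  have key := A.hasDerivAt_energy B ℓ hB κ hG hφ hℓ hC hCU hη hΦ hΦ0 hout
  have h0 : (0 : ℝ) ∈ Ioo (-η) η := ⟨by linarith, hη⟩
  rwa [setIntegral_congr_fun (g := fun _ => (0 : ℝ)) hC.measurableSet, integral_zero,
    neg_zero] at key
  intro x hx
  refine horth x (hCU hx) η hη _ ?_ (hΦ0 x (hCU hx)) fun s hs => hN s hs x (hCU hx)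
  have hq : DifferentiableAt ℝ (fun q : ℝ × Plane => Φ q.1 q.2) (0, x) :=
    (hΦ.contDiffAt ((isOpen_Ioo.prod A.isOpen).mem_nhds ⟨h0, hCU hx⟩)).differentiableAt (by simp)
  exact DifferentiableAt.comp (g := fun q : ℝ × Plane => Φ q.1 q.2) (f := fun s : ℝ => (s, x))
    0 hq (by fun_prop)

/-- The Laplacian of a critical map is orthogonal to the velocities of one-parameter families of
transformations of `N`. -/
theorem Definite.orthogonal_of_isCritical (hφN : ∀ x ∈ U, φ x ∈ N)
    (hcrit : IsCritical U (secondForm f n) N G φ) {R : ℝ → V → V}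
    (hR : ContDiff ℝ ∞ (fun q : ℝ × V => R q.1 q.2)) (hR0 : ∀ v, R 0 v = v)
    (hRN : ∀ t, ∀ v ∈ N, R t v ∈ N) {X : V → V}
    (hX : ∀ v, HasDerivAt (fun t => R t v) (X v) 0) :
    ∀ x ∈ U, B (X (φ x)) (divGrad (Definite.dens f n) φ x) = 0 := by
  set q : Plane → ℝ := fun x => B (X (φ x)) (divGrad (Definite.dens f n) φ x) with hq
  have hXsm : Continuous X := by
    have e : X = fun v => fderiv ℝ (fun q : ℝ × V => R q.1 q.2) (0, v) (1, 0) := by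
      funext v
      have h1 : HasDerivAt (fun s : ℝ => (s, v)) ((1 : ℝ), (0 : V)) 0 :=
        (hasDerivAt_id (0 : ℝ)).prodMk (hasDerivAt_const 0 v)
      exact (hX v).unique (HasFDerivAt.comp_hasDerivAt (l := fun q : ℝ × V => R q.1 q.2) 0
        ((hR.differentiable (by simp)) (0, v)).hasFDerivAt h1)
    rw [e]
    exact ((hR.continuous_fderiv (by simp)).comp (by fun_prop)).clm_apply continuous_const
  have hqc : ContinuousOn q U :=
    (B.continuous.comp_continuousOn (hXsm.comp_continuousOn hφ.continuousOn)).clm_apply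
      (contDiffOn_divGrad A.isOpen A.smooth_dens hφ).continuousOn
  -- The fundamental lemma of the calculus of variations: test against bump functions, then use
  -- continuity to pass from almost everywhere to everywhere.
  have hae : ∀ᵐ x ∂(volume : Measure Plane), x ∈ U → q x = 0 := by
    refine A.isOpen.ae_eq_zero_of_integral_contDiff_smul_eq_zero
      (hqc.locallyIntegrableOn A.isOpen.measurableSet) fun χ hχ hχc hχU => ?_
    set C := tsupport χ
    have hC : IsCompact C := hχc
    have hχ0 : ∀ x ∉ C, χ x = 0 := fun x hx => image_eq_zero_of_notMem_tsupport hx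
    -- Cutting off the group parameter instead of the vector field keeps the variation inside `N`
    -- exactly; its initial velocity is `χ` times the generator.
    set Φ : ℝ → Plane → V := fun s x => R (s * χ x) (φ x) with hΦdef
    have hΦ : ContDiffOn ℝ ∞ (fun q : ℝ × Plane => Φ q.1 q.2) (Ioo (-1) 1 ×ˢ U) := by
      refine hR.comp_contDiffOn (ContDiffOn.prodMk ?_ ?_)
      · exact (contDiff_fst.mul (hχ.comp contDiff_snd)).contDiffOn
      · exact hφ.comp contDiff_snd.contDiffOn fun q hq => hq.2
    have hΦ0 : ∀ x ∈ U, Φ 0 x = φ x := fun x _ => by simp [hΦdef, hR0]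
    have hout : ∀ s ∈ Ioo (-1 : ℝ) 1, ∀ x ∈ U \ C, Φ s x = φ x := fun s _ x hx => by
      simp [hΦdef, hχ0 x hx.2, hR0]
    have h1 := hcrit C hC hχU 1 one_pos Φ hΦ (fun s _ x hx => hRN _ _ (hφN x hx)) hΦ0 hout
    have h2 := A.hasDerivAt_energy B ℓ hB κ hG hφ hℓ hC hχU one_pos hΦ hΦ0 hout
    have h3 := neg_eq_zero.1 (h1.unique h2).symm
    have h4 : ∀ x, deriv (fun s => Φ s x) 0 = χ x • X (φ x) := by
      intro x
      have e1 : HasDerivAt (fun s : ℝ => s * χ x) (χ x) 0 := by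
        simpa using (hasDerivAt_id (0 : ℝ)).mul_const (χ x)
      have e2 : HasDerivAt (fun t => R t (φ x)) (X (φ x)) (0 * χ x) := by
        simpa using hX (φ x)
      exact (e2.scomp 0 e1).deriv
    rw [← setIntegral_eq_integral_of_forall_compl_eq_zero (s := C)
      (fun x hx => by simp [hχ0 x hx]), ← h3]
    refine setIntegral_congr_fun hC.measurableSet fun x _ => ?_
    simp [h4, hq]
  have := Measure.eqOn_open_of_ae_eq (μ := (volume : Measure Plane)) (f := q) (g := fun _ => 0)
    ((ae_restrict_iff' A.isOpen.measurableSet).2 hae) A.isOpen hqc continuousOn_const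
  exact fun x hx => this hx

end Criteria

section LorentzGroup

/-! ### One-parameter groups of Lorentz transformations -/

/-- The identity matrix with the `(a, b)`-block replaced by `(c, s'; s, c)`. -/
def planeMatrix (a b : Fin 4) (c s' s : ℝ) : Matrix (Fin 4) (Fin 4) ℝ := Matrix.of fun i j =>
  if i = a ∧ j = a ∨ i = b ∧ j = b then c else if i = a ∧ j = b then s'
  else if i = b ∧ j = a then s else if i = j then 1 else 0

/-- The boosts (for `a = 0`) and rotations in the `(a, b)`-plane. -/
noncomputable def lorentz (a b : Fin 4) (t : ℝ) : Matrix (Fin 4) (Fin 4) ℝ :=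
  if a = 0 then planeMatrix a b (Real.cosh t) (Real.sinh t) (Real.sinh t)
  else planeMatrix a b (Real.cos t) (-Real.sin t) (Real.sin t)

/-- The generator of `lorentz a b`. -/
def lorentzGen (a b : Fin 4) : Matrix (Fin 4) (Fin 4) ℝ := Matrix.of fun i j =>
  if i = a ∧ j = b then -sgn a else if i = b ∧ j = a then 1 else 0

theorem mink_planeMatrix_boost {b : Fin 4} (hb : 0 < b) {c s : ℝ} (h : c * c - s * s = 1)
    (x y : E13) : mink (planeMatrix 0 b c s s *ᵥ x) (planeMatrix 0 b c s s *ᵥ y) = mink x y := by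
  fin_cases b <;>
    simp [planeMatrix, mink, Matrix.mulVec, dotProduct, Fin.sum_univ_four] at hb ⊢
  · linear_combination (-(x 0 * y 0) + x 1 * y 1) * h
  · linear_combination (-(x 0 * y 0) + x 2 * y 2) * h
  · linear_combination (-(x 0 * y 0) + x 3 * y 3) * h

theorem mink_planeMatrix_rotation {a b : Fin 4} (ha : 0 < a) (hb : a < b) {c s : ℝ}
    (h : c * c + s * s = 1) (x y : E13) :
    mink (planeMatrix a b c (-s) s *ᵥ x) (planeMatrix a b c (-s) s *ᵥ y) = mink x y := by
  fin_cases a <;> fin_cases b <;>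
    simp [planeMatrix, mink, Matrix.mulVec, dotProduct, Fin.sum_univ_four] at ha hb ⊢
  · linear_combination (x 1 * y 1 + x 2 * y 2) * h
  · linear_combination (x 1 * y 1 + x 3 * y 3) * h
  · linear_combination (x 2 * y 2 + x 3 * y 3) * h

variable {a b : Fin 4} (hab : a < b)

theorem lorentz_zero : lorentz a b 0 = 1 := by
  rw [lorentz]
  ext i j
  split_ifs <;> simp [planeMatrix, Matrix.one_apply] <;> grind

theorem contDiff_lorentz (i j : Fin 4) : ContDiff ℝ ∞ fun t => lorentz a b t i j := by
  by_cases ha : a = 0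
  · simp only [lorentz, ha, if_true, planeMatrix, Matrix.of_apply]
    split_ifs
    exacts [Real.contDiff_cosh, Real.contDiff_sinh, Real.contDiff_sinh, contDiff_const,
      contDiff_const]
  · simp only [lorentz, ha, if_false, planeMatrix, Matrix.of_apply]
    split_ifs
    exacts [Real.contDiff_cos, Real.contDiff_sin.neg, Real.contDiff_sin, contDiff_const,
      contDiff_const]

include hab

theorem mink_lorentz (t : ℝ) (x y : E13) :
    mink (lorentz a b t *ᵥ x) (lorentz a b t *ᵥ y) = mink x y := by
  by_cases ha : a = 0
  · subst ha
    rw [lorentz, if_pos rfl]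
    exact mink_planeMatrix_boost hab (by have := Real.cosh_sq t; nlinarith) x y
  · rw [lorentz, if_neg ha]
    exact mink_planeMatrix_rotation (Fin.pos_of_ne_zero ha) hab
      (by have := Real.sin_sq_add_cos_sq t; nlinarith) x y

/-- Only the choice of sheet needs an argument. Rotations fix x₀, and for boosts |sinh t| < cosh t
and |x_b| < x₀ keep it positive. -/
theorem lorentz_mem_H3 (t : ℝ) {x : E13} (hx : x ∈ H3) : lorentz a b t *ᵥ x ∈ H3 := by
  refine ⟨by rw [mink_lorentz hab, hx.1], ?_⟩
  have h1 := hx.1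
  have h2 := hx.2
  have hlt : ∀ k : Fin 4, 0 < k → x k * x k < x 0 * x 0 := by
    intro k hk
    simp only [mink] at h1
    fin_cases k <;> simp at hk ⊢ <;> nlinarith [sq_nonneg (x 1), sq_nonneg (x 2), sq_nonneg (x 3)]
  by_cases ha : a = 0
  · subst ha
    have e : (lorentz 0 b t *ᵥ x) 0 = Real.cosh t * x 0 + Real.sinh t * x b := by
      rw [lorentz, if_pos rfl]
      fin_cases b <;>
        simp [planeMatrix, Matrix.mulVec, dotProduct, Fin.sum_univ_four] at hab ⊢
    have h3 := abs_lt_of_sq_lt_sq (by simpa [sq] using hlt b hab) h2.le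
    have h4 : |Real.sinh t| < Real.cosh t :=
      abs_lt_of_sq_lt_sq (by rw [Real.cosh_sq]; linarith) (Real.cosh_pos t).le
    have h5 : |Real.sinh t * x b| ≤ |Real.sinh t| * x 0 := by
      rw [abs_mul]; exact mul_le_mul_of_nonneg_left h3.le (abs_nonneg _)
    have h6 := neg_abs_le (Real.sinh t * x b)
    rw [e]
    nlinarith [mul_lt_mul_of_pos_right h4 h2]
  · have e : (lorentz a b t *ᵥ x) 0 = x 0 := by
      rw [lorentz, if_neg ha]
      fin_cases a <;> fin_cases b <;>
        simp [planeMatrix, Matrix.mulVec, dotProduct] at ha hab ⊢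
    rw [e]; exact h2

theorem lorentz_mem_UH3 (t : ℝ) {p : E13 × E13} (hp : p ∈ UH3) :
    (lorentz a b t *ᵥ p.1, lorentz a b t *ᵥ p.2) ∈ UH3 :=
  ⟨lorentz_mem_H3 hab t hp.1, by simp only [mink_lorentz hab, hp.2.1],
    by simp only [mink_lorentz hab, hp.2.2]⟩

theorem hasDerivAt_lorentz (i j : Fin 4) :
    HasDerivAt (fun t => lorentz a b t i j) (lorentzGen a b i j) 0 := by
  have hne : a ≠ b := hab.ne
  by_cases ha : a = 0
  · subst ha
    have h1 : HasDerivAt Real.cosh 0 0 := by simpa using Real.hasDerivAt_cosh 0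
    have h2 : HasDerivAt Real.sinh 1 0 := by simpa using Real.hasDerivAt_sinh 0
    simp only [lorentz, if_true, planeMatrix, Matrix.of_apply, lorentzGen, sgn, neg_neg]
    split_ifs
    all_goals first | exact h1 | exact h2 | exact hasDerivAt_const _ _ | (exfalso; grind)
  · have h1 : HasDerivAt Real.cos 0 0 := by simpa using Real.hasDerivAt_cos 0
    have h2 : HasDerivAt Real.sin 1 0 := by simpa using Real.hasDerivAt_sin 0
    have h3 : HasDerivAt (fun t => -Real.sin t) (-1) 0 := h2.neg
    simp only [lorentz, ha, if_false, planeMatrix, Matrix.of_apply, lorentzGen, sgn]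
    split_ifs
    all_goals first | exact h1 | exact h2 | exact h3 | exact hasDerivAt_const _ _ | (exfalso; grind)

theorem hasDerivAt_lorentz_mulVec (x : E13) :
    HasDerivAt (fun t => lorentz a b t *ᵥ x) (lorentzGen a b *ᵥ x) 0 := by
  rw [hasDerivAt_pi]
  intro i
  simp only [Matrix.mulVec, dotProduct]
  exact HasDerivAt.fun_sum fun j _ => (hasDerivAt_lorentz hab i j).mul_const (x j)

/-- Orthogonality to infinitesimal Lorentz transformations thereby becomes a statement about Plücker
coordinates. -/
theorem mink_lorentzGen (x y : E13) :
    mink (lorentzGen a b *ᵥ x) y = wedge x y a b := by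
  fin_cases a <;> fin_cases b <;>
    simp [lorentzGen, sgn, wedge, mink, Matrix.mulVec, dotProduct] at hab ⊢ <;>
    ring

omit hab

/-- The action of a matrix on bivectors. -/
def bivectorAct (g : Matrix (Fin 4) (Fin 4) ℝ) (A : Bivector) : Bivector := fun i j =>
  ∑ k, ∑ l, g i k * g j l * A k l

theorem bivectorAct_wedge (g : Matrix (Fin 4) (Fin 4) ℝ) (x v : E13) :
    bivectorAct g (wedge x v) = wedge (g *ᵥ x) (g *ᵥ v) := by
  ext i j
  simp [bivectorAct, wedge, Matrix.mulVec, dotProduct, Fin.sum_univ_four]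
  ring

theorem bivectorAct_one (A : Bivector) : bivectorAct 1 A = A := by
  ext i j
  simp [bivectorAct, Matrix.one_apply]

theorem contDiff_bivectorAct :
    ContDiff ℝ ∞ fun q : ℝ × Bivector => bivectorAct (lorentz a b q.1) q.2 := by
  rw [contDiff_pi]; intro i
  rw [contDiff_pi]; intro j
  refine ContDiff.sum fun k _ => ContDiff.sum fun l _ => ContDiff.mul ?_ ?_
  · exact ((contDiff_lorentz i k).comp contDiff_fst).mul ((contDiff_lorentz j l).comp contDiff_fst)
  · exact contDiff_apply_apply ℝ ℝ k l |>.comp contDiff_snd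

theorem contDiff_lorentz_mulVec {V : Type*} [NormedAddCommGroup V] [NormedSpace ℝ V]
    {τ : V → ℝ} {φ : V → E13} (hτ : ContDiff ℝ ∞ τ) (hφ : ContDiff ℝ ∞ φ) :
    ContDiff ℝ ∞ fun q => lorentz a b (τ q) *ᵥ φ q := by
  rw [contDiff_pi]; intro i
  simp only [Matrix.mulVec, dotProduct]
  exact ContDiff.sum fun j _ => ((contDiff_lorentz i j).comp hτ).mul ((contDiff_pi.1 hφ) j)

theorem exists_hasDerivAt_bivectorAct (A : Bivector) :
    ∃ A', HasDerivAt (fun t => bivectorAct (lorentz a b t) A) A' 0 :=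
  ⟨_, ((contDiff_bivectorAct.comp (contDiff_id.prodMk contDiff_const)).differentiable
    (by simp) 0).hasDerivAt⟩

end LorentzGroup

/-! ### Tangent vectors of the two targets and harmonicity of the Gauss maps. -/

theorem pd_prodMk {V W : Type*} [NormedAddCommGroup V] [NormedSpace ℝ V] [NormedAddCommGroup W]
    [NormedSpace ℝ W] {φ : Plane → V} {ψ : Plane → W} {x : Plane} (hφ : DifferentiableAt ℝ φ x)
    (hψ : DifferentiableAt ℝ ψ x) (i : Fin 2) :
    pd i (fun y => (φ y, ψ y)) x = (pd i φ x, pd i ψ x) := by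
  simp only [pd]
  rw [DifferentiableAt.fderiv_prodMk hφ hψ]; rfl

theorem biForm_comm (A B : Bivector) : biForm A B = biForm B A := by
  simp [biForm, Fin.sum_univ_four]; ring

/-- The form required by `hasDerivAt_energy`, with κ = 1/4 and the contact form `crossL`, which
vanishes along the Legendrian map. -/
theorem unitMetric_eq (b w w' : E13 × E13) :
    unitMetric b w w' = unitL w w' - 1 / 4 * (crossL b w * crossL b w') := by
  rw [unitMetric, unitL_apply, crossL_apply, crossL_apply]; ring

theorem geoMetric_eq (b w w' : Bivector) :
    geoMetric b w w' = geoL w w' - 0 * ((0 : Bivector →L[ℝ] Bivector →L[ℝ] ℝ) b w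
      * (0 : Bivector →L[ℝ] Bivector →L[ℝ] ℝ) b w') := by
  rw [geoL_apply, geoMetric]; simp

/-- A constant quadratic expression in a curve has derivative zero. -/
theorem bilin_deriv_eq_zero {V : Type*} [NormedAddCommGroup V] [NormedSpace ℝ V]
    (B : V →L[ℝ] V →L[ℝ] ℝ) {γ : ℝ → V} (hγ : DifferentiableAt ℝ γ 0) {η c : ℝ} (hη : 0 < η)
    (hc : ∀ s ∈ Ioo (-η) η, B (γ s) (γ s) = c) :
    B (deriv γ 0) (γ 0) + B (γ 0) (deriv γ 0) = 0 := by
  have h1 := (B.hasFDerivAt.comp_hasDerivAt 0 hγ.hasDerivAt).clm_apply hγ.hasDerivAt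
  have h2 : (fun s => B (γ s) (γ s)) =ᶠ[nhds 0] fun _ => c := by
    filter_upwards [Ioo_mem_nhds (show -η < 0 by linarith) hη] with s hs using hc s hs
  exact h1.unique ((hasDerivAt_const 0 c).congr_of_eventuallyEq h2)

/-- The form `⟨x, y⟩` on pairs `(x, ·)`, `(y, ·)`. -/
noncomputable def fstL : E13 × E13 →L[ℝ] E13 × E13 →L[ℝ] ℝ :=
  minkL.bilinearComp (ContinuousLinearMap.fst ℝ E13 E13) (ContinuousLinearMap.fst ℝ E13 E13)

/-- The form `⟨v, w⟩` on pairs `(·, v)`, `(·, w)`. -/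
noncomputable def sndL : E13 × E13 →L[ℝ] E13 × E13 →L[ℝ] ℝ :=
  minkL.bilinearComp (ContinuousLinearMap.snd ℝ E13 E13) (ContinuousLinearMap.snd ℝ E13 E13)

theorem tangent_UH3 {γ : ℝ → E13 × E13} (hγ : DifferentiableAt ℝ γ 0) {η : ℝ} (hη : 0 < η)
    (hN : ∀ s ∈ Ioo (-η) η, γ s ∈ UH3) :
    mink (deriv γ 0).1 (γ 0).1 = 0 ∧ mink (deriv γ 0).2 (γ 0).2 = 0 ∧
      mink (deriv γ 0).1 (γ 0).2 + mink (γ 0).1 (deriv γ 0).2 = 0 := by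
  have h1 : mink (deriv γ 0).1 (γ 0).1 + mink (γ 0).1 (deriv γ 0).1 = 0 :=
    bilin_deriv_eq_zero fstL hγ hη (c := -1) fun s hs => (hN s hs).1.1
  have h2 : mink (deriv γ 0).2 (γ 0).2 + mink (γ 0).2 (deriv γ 0).2 = 0 :=
    bilin_deriv_eq_zero sndL hγ hη (c := 1) fun s hs => (hN s hs).2.1
  have h3 : mink (γ 0).1 (deriv γ 0).2 + mink (deriv γ 0).1 (γ 0).2 = 0 :=
    bilin_deriv_eq_zero crossL hγ hη (c := 0) fun s hs => (hN s hs).2.2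
  rw [mink_comm (γ 0).1] at h1
  rw [mink_comm (γ 0).2] at h2
  exact ⟨by linarith, by linarith, by linarith⟩

/-- Since the norm is constant on `Geo`, every velocity of a curve in `Geo` is orthogonal to its
base point. -/
theorem geoL_self_of_mem {A : Bivector} (hA : A ∈ Geo) : geoL A A = -1 / 4 := by
  obtain ⟨b, hb, rfl⟩ := hA
  rw [geoL_apply, biForm_wedge, hb.1.1, hb.2.1, hb.2.2, mink_comm, hb.2.2]
  norm_num

namespace Definite

variable {U : Set Plane} {f n : Plane → E13} (A : Definite U (-1) 1 f n)

include A

theorem divGrad_pair {x : Plane} (hx : x ∈ U) : divGrad (dens f n) (fun y => (f y, n y)) x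
    = (divGrad (dens f n) f x, divGrad (dens f n) n x) := by
  have h1 : ∀ j, ∀ y ∈ U, pd j (fun y => (f y, n y)) y = (pd j f y, pd j n y) := fun j y hy =>
    pd_prodMk (A.diff hy) (A.diff_normal hy) j
  have hs := A.smooth.prodMk A.smooth_normal
  have h2 : ∀ i j, pd i (pd j fun y => (f y, n y)) x = (pd i (pd j f) x, pd i (pd j n) x) := by
    intro i j
    rw [pd_congr A.isOpen (h1 j) hx, pd_prodMk (A.diff_pd hx j) (A.diff_pd_normal hx j)]
  rw [A.divGrad_eq hx hs, A.divGrad_eq hx A.smooth, A.divGrad_eq hx A.smooth_normal]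
  simp only [h1 _ x hx, h2, Fin.sum_univ_two]
  simp

theorem smooth_wedge : ContDiffOn ℝ ∞ (fun y => wedge (f y) (n y)) U :=
  (wedgeL.contDiff.comp_contDiffOn A.smooth).clm_apply A.smooth_normal

theorem crossL_eq_zero : ∀ x ∈ U, ∀ i, crossL (f x, n x) (pd i (fun y => (f y, n y)) x) = 0 := by
  intro x hx i
  rw [pd_prodMk (A.diff hx) (A.diff_normal hx)]
  exact A.tangent x hx i

theorem isCritical_legendrian (h : ∀ x ∈ U, ∀ l, pd l (detRatio f n) x = 0) :
    IsCritical U (secondForm f n) UH3 unitMetric fun x => (f x, n x) := by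
  refine A.isCritical_of_orthogonal unitL crossL
    (fun u v => by rw [unitL_apply, unitL_apply, mink_comm u.1, mink_comm u.2])
    (1 / 4) unitMetric_eq (A.smooth.prodMk A.smooth_normal) A.crossL_eq_zero ?_
  intro x hx η hη γ hγ h0 hN
  obtain ⟨h1, h2, h3⟩ := tangent_UH3 hγ hη hN
  rw [h0] at h1 h2 h3
  rw [A.divGrad_pair hx, unitL_apply]
  simp only at h1 h2 h3 ⊢
  rw [A.divGrad_eq_span hx (h x hx), A.divGrad_normal_eq_span hx (h x hx),
    A.mink_divGrad_normal_comm hx]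
  simp only [mink_add_right, mink_smul_right, h1, h2]
  rw [mink_comm (deriv γ 0).2 (f x)]
  -- What remains is ⟨Δf, n⟩ times the derivative of the constraint ⟨x, v⟩ = 0; the opposite norms
  -- of `f` and `n` match the minus sign in the metric.
  linear_combination mink (divGrad (dens f n) f x) (n x) / 4 * h3

theorem isCritical_lagrangian (h : ∀ x ∈ U, ∀ l, pd l (detRatio f n) x = 0) :
    IsCritical U (secondForm f n) Geo geoMetric fun x => wedge (f x) (n x) := by
  refine A.isCritical_of_orthogonal geoL 0 (fun u v => by rw [geoL_apply, geoL_apply, biForm_comm])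
    0 geoMetric_eq A.smooth_wedge (fun _ _ _ => rfl) ?_
  intro x hx η hη γ hγ h0 hN
  have h1 := bilin_deriv_eq_zero geoL hγ hη fun s hs => geoL_self_of_mem (hN s hs)
  rw [geoL_apply, geoL_apply, biForm_comm (γ 0), h0] at h1
  have e : divGrad (dens f n) (fun y => wedge (f y) (n y)) x
      = (-mink (divGrad (dens f n) f x) (f x) + mink (divGrad (dens f n) n x) (n x))
        • wedge (f x) (n x) := by
    rw [A.divGrad_wedge hx]
    nth_rw 1 [A.divGrad_eq_span hx (h x hx)]
    nth_rw 1 [A.divGrad_normal_eq_span hx (h x hx)]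
    ext i j
    simp [wedge]
    ring
  rw [e, map_smul, geoL_apply, smul_eq_mul]
  have h2 : biForm (deriv γ 0) (wedge (f x) (n x)) = 0 := by linarith
  rw [h2]; ring

variable (hH : ∀ x ∈ U, f x ∈ H3)

/-- The criterion for harmonicity obtained from the infinitesimal Lorentz transformations. -/
theorem tangent_eq_zero_of_wedge {x : Plane} (hx : x ∈ U)
    (h : ∀ a b : Fin 4, a < b → wedge (f x) (divGrad (dens f n) f x) a b
      = wedge (n x) (divGrad (dens f n) n x) a b) (k : Fin 2) :
    mink (divGrad (dens f n) f x) (pd k f x) = 0 := by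
  have hskew : ∀ (x v : E13) (a b : Fin 4), wedge x v a b = -wedge x v b a := fun x v a b => by
    simp [wedge]
  have e : wedge (f x) (divGrad (dens f n) f x) = wedge (n x) (divGrad (dens f n) n x) := by
    ext a b
    rcases lt_trichotomy a b with hab | rfl | hab
    · exact h a b hab
    · simp [wedge]
    · rw [hskew, h b a hab, ← hskew]
  -- The left side becomes -⟨Δf, ∂ₖf⟩. The right side is zero, since `n` is orthogonal to both `f`
  -- and ∂ₖf.
  have e2 := congrArg (fun A => biForm A (wedge (f x) (pd k f x))) e
  simp only [biForm_wedge] at e2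
  rw [A.norm x hx, mink_comm (f x) (pd k f x), A.pd_orth hx, mink_comm (n x) (f x), A.orth x hx,
    mink_comm (n x) (pd k f x), A.tangent x hx] at e2
  linarith

include hH

theorem mem_UH3 : ∀ x ∈ U, (f x, n x) ∈ UH3 := fun x hx =>
  ⟨hH x hx, A.norm' x hx, A.orth x hx⟩

theorem tangent_eq_zero_of_legendrian
    (hcrit : IsCritical U (secondForm f n) UH3 unitMetric fun x => (f x, n x))
    {x : Plane} (hx : x ∈ U) (k : Fin 2) : mink (divGrad (dens f n) f x) (pd k f x) = 0 := by
  refine A.tangent_eq_zero_of_wedge hx (fun a b hab => ?_) k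
  have key := A.orthogonal_of_isCritical unitL crossL
    (fun u v => by rw [unitL_apply, unitL_apply, mink_comm u.1, mink_comm u.2])
    (1 / 4) unitMetric_eq (A.smooth.prodMk A.smooth_normal) A.crossL_eq_zero (A.mem_UH3 hH) hcrit
    (R := fun t p => (lorentz a b t *ᵥ p.1, lorentz a b t *ᵥ p.2))
    ((contDiff_lorentz_mulVec contDiff_fst (contDiff_fst.comp contDiff_snd)).prodMk
      (contDiff_lorentz_mulVec contDiff_fst (contDiff_snd.comp contDiff_snd)))
    (fun v => by simp [lorentz_zero]) (fun t v hv => lorentz_mem_UH3 hab t hv)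
    (fun v => (hasDerivAt_lorentz_mulVec hab v.1).prodMk (hasDerivAt_lorentz_mulVec hab v.2)) x hx
  rw [A.divGrad_pair hx, unitL_apply] at key
  simp only [mink_lorentzGen hab] at key
  linarith

/-- The pairing with the generator gives the Legendrian condition plus (⟨Δn, f⟩ - ⟨Δf, n⟩) times a
component of f ∧ n, which vanishes by `mink_divGrad_normal_comm`. -/
theorem tangent_eq_zero_of_lagrangian
    (hcrit : IsCritical U (secondForm f n) Geo geoMetric fun x => wedge (f x) (n x))
    {x : Plane} (hx : x ∈ U) (k : Fin 2) : mink (divGrad (dens f n) f x) (pd k f x) = 0 := by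
  refine A.tangent_eq_zero_of_wedge hx (fun a b hab => ?_) k
  choose X hX using exists_hasDerivAt_bivectorAct (a := a) (b := b)
  have key := A.orthogonal_of_isCritical (N := Geo) geoL 0
    (fun u v => by rw [geoL_apply, geoL_apply, biForm_comm])
    0 geoMetric_eq A.smooth_wedge (fun _ _ _ => rfl)
    (fun x hx => ⟨_, A.mem_UH3 hH x hx, rfl⟩) hcrit
    (R := fun t v => bivectorAct (lorentz a b t) v) contDiff_bivectorAct
    (fun v => by simp only [lorentz_zero, bivectorAct_one])
    (by
      rintro t _ ⟨p, hp, rfl⟩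
      exact ⟨_, lorentz_mem_UH3 hab t hp, bivectorAct_wedge _ _ _⟩) hX x hx
  have hXe : X (wedge (f x) (n x)) = wedge (lorentzGen a b *ᵥ f x) (n x)
      + wedge (f x) (lorentzGen a b *ᵥ n x) := by
    refine (hX _).unique ?_
    have h1 := (wedgeL.hasFDerivAt.comp_hasDerivAt 0 (hasDerivAt_lorentz_mulVec hab (f x))).clm_apply
      (hasDerivAt_lorentz_mulVec hab (n x))
    simp only [lorentz_zero, Matrix.one_mulVec, Function.comp_apply] at h1
    simp only [bivectorAct_wedge]
    exact h1
  have c := A.mink_divGrad_normal_comm hx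
  have h0 : ∀ z : E13, wedge z z a b = 0 := fun z => by simp [wedge]; ring
  have hsk : wedge (n x) (f x) a b = -wedge (f x) (n x) a b := by simp [wedge]; ring
  rw [hXe, A.divGrad_wedge hx, geoL_apply, biForm_add] at key
  simp only [biForm_wedge, mink_lorentzGen hab, A.norm x hx, A.norm' x hx, A.orth x hx,
    mink_comm (n x) (f x), h0] at key
  rw [hsk, mink_comm (n x) (divGrad (dens f n) f x), mink_comm (f x) (divGrad (dens f n) n x),
    c] at key
  linear_combination 4 * key

end Definite

/-! ### Passage from the surface to charts. -/

/-- The matrix of scalar products of the images of the coordinate vectors. -/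
noncomputable def pairMatrix (α γ : Plane →L[ℝ] E13) : Matrix (Fin 2) (Fin 2) ℝ :=
  Matrix.of fun i j => mink (α (EuclideanSpace.single i 1)) (γ (EuclideanSpace.single j 1))

theorem clm_plane_apply (α : Plane →L[ℝ] E13) (v : Plane) :
    α v = v 0 • α (EuclideanSpace.single 0 1) + v 1 • α (EuclideanSpace.single 1 1) := by
  have : v = v 0 • EuclideanSpace.single 0 1 + v 1 • EuclideanSpace.single 1 1 := by
    ext i; fin_cases i <;> simp
  conv_lhs => rw [this]
  simp only [map_add, map_smul]

/-- The determinant of an endomorphism of the coordinate plane. -/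
noncomputable def planeDet (b : Plane →L[ℝ] Plane) : ℝ :=
  b (EuclideanSpace.single 0 1) 0 * b (EuclideanSpace.single 1 1) 1
    - b (EuclideanSpace.single 0 1) 1 * b (EuclideanSpace.single 1 1) 0

/-- A change of coordinates multiplies det I and det II by the same factor, so their quotient is a
function on the surface. -/
theorem det_pairMatrix_comp (α γ : Plane →L[ℝ] E13) (b : Plane →L[ℝ] Plane) :
    (pairMatrix (α.comp b) (γ.comp b)).det = planeDet b ^ 2 * (pairMatrix α γ).det := by
  simp only [pairMatrix, Matrix.det_fin_two, Matrix.of_apply, ContinuousLinearMap.comp_apply,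
    clm_plane_apply α (b _), clm_plane_apply γ (b _), mink_add_left, mink_add_right,
    mink_smul_left, mink_smul_right, planeDet]
  ring

/-- The orthogonal complement of a timelike vector is spacelike. Cauchy-Schwarz for the space
components gives v₀²p₀² ≤ |v|²(p₀² - 1), where |v|² is the sum of the squares of those of `v`. -/
theorem mink_self_pos_of_orth {p v : E13} (hp : p ∈ H3) (hv : mink v p = 0) (hne : v ≠ 0) :
    0 < mink v v := by
  have h1 := hp.1
  have h2 := hp.2
  simp only [mink] at *
  have hs : 0 < v 1 * v 1 + v 2 * v 2 + v 3 * v 3 := by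
    by_contra hcon
    have e1 : v 1 = 0 := by nlinarith [sq_nonneg (v 1), sq_nonneg (v 2), sq_nonneg (v 3)]
    have e2 : v 2 = 0 := by nlinarith [sq_nonneg (v 1), sq_nonneg (v 2), sq_nonneg (v 3)]
    have e3 : v 3 = 0 := by nlinarith [sq_nonneg (v 1), sq_nonneg (v 2), sq_nonneg (v 3)]
    have e0 : v 0 = 0 := by
      rw [e1, e2, e3] at hv
      have : v 0 * p 0 = 0 := by linarith
      exact (mul_eq_zero.1 this).resolve_right h2.ne'
    exact hne (by ext i; fin_cases i <;> assumption)
  have hcs : (v 0 * p 0) * (v 0 * p 0)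
      ≤ (v 1 * v 1 + v 2 * v 2 + v 3 * v 3) * (p 1 * p 1 + p 2 * p 2 + p 3 * p 3) := by
    have : v 0 * p 0 = v 1 * p 1 + v 2 * p 2 + v 3 * p 3 := by linarith
    rw [this]
    nlinarith [sq_nonneg (v 1 * p 2 - v 2 * p 1), sq_nonneg (v 1 * p 3 - v 3 * p 1),
      sq_nonneg (v 2 * p 3 - v 3 * p 2)]
  have hp0 : p 1 * p 1 + p 2 * p 2 + p 3 * p 3 = p 0 * p 0 - 1 := by linarith
  rw [hp0] at hcs
  have hpp : 0 < p 0 * p 0 := mul_pos h2 h2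
  have : 0 < (-(v 0 * v 0) + v 1 * v 1 + v 2 * v 2 + v 3 * v 3) * (p 0 * p 0) := by nlinarith
  exact pos_of_mul_pos_left this hpp.le

section Charts

variable {M : Type*} [TopologicalSpace M] [ChartedSpace Plane M]

/-- The differential of a vector-valued map at `p`, in the model space. -/
noncomputable def differential (f : M → E13) (p : M) : Plane →L[ℝ] E13 := mfderiv (𝓡 2) 𝓘(ℝ, E13) f p

/-- The quotient of the determinants of the fundamental forms. -/
noncomputable def surfaceRatio (f n : M → E13) (p : M) : ℝ :=
  (-pairMatrix (differential f p) (differential n p)).det / (pairMatrix (differential f p) (differential f p)).det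

variable {e : OpenPartialHomeomorph M Plane}
  (he : e ∈ IsManifold.maximalAtlas (𝓡 2) ∞ M)

include he

theorem contDiffOn_comp_symm {V : Type*} [NormedAddCommGroup V] [NormedSpace ℝ V] {φ : M → V}
    (hφ : ContMDiff (𝓡 2) 𝓘(ℝ, V) ∞ φ) : ContDiffOn ℝ ∞ (fun x => φ (e.symm x)) e.target :=
  contMDiffOn_iff_contDiffOn.1 (hφ.comp_contMDiffOn (contMDiffOn_symm_of_mem_maximalAtlas he))

theorem mdifferentiable_of_mem_maximalAtlas : e.MDifferentiable (𝓡 2) (𝓡 2) :=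
  ⟨(contMDiffOn_of_mem_maximalAtlas he).mdifferentiableOn (by simp),
    (contMDiffOn_symm_of_mem_maximalAtlas he).mdifferentiableOn (by simp)⟩

/-- The differential of the inverse of a chart. -/
theorem exists_fderiv_comp_symm {x : Plane} (hx : x ∈ e.target) :
    ∃ b : Plane →L[ℝ] Plane, Function.Injective b ∧ ∀ φ : M → E13,
      ContMDiff (𝓡 2) 𝓘(ℝ, E13) ∞ φ →
      fderiv ℝ (fun y => φ (e.symm y)) x = (differential φ (e.symm x)).comp b := by
  have hm := mdifferentiable_of_mem_maximalAtlas he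
  refine ⟨mfderiv (𝓡 2) (𝓡 2) e.symm x, hm.symm.mfderiv_injective hx, fun φ hφ => ?_⟩
  have h := mfderiv_comp (I := 𝓡 2) (I' := 𝓡 2) (I'' := 𝓘(ℝ, E13)) x
    ((hφ.mdifferentiable (by simp)) (e.symm x)) (hm.mdifferentiableAt_symm hx)
  rw [← mfderiv_eq_fderiv]
  exact h

omit he

variable {f n : M → E13} (hf : IsSurface f n)

include hf

theorem IsSurface.mink_differential (p : M) (v : Plane) : mink (differential f p v) (n p) = 0 :=
  hf.normal p v

include he

theorem IsSurface.det_firstForm_pos {x : Plane} (hx : x ∈ e.target) :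
    0 < (firstForm (fun x => f (e.symm x)) x).det := by
  obtain ⟨b, hbi, hb⟩ := exists_fderiv_comp_symm he hx
  have hinj : Function.Injective (fderiv ℝ (fun x => f (e.symm x)) x) := by
    rw [hb f hf.smooth]
    exact (hf.immersion (e.symm x)).comp hbi
  have horth : ∀ v, mink (fderiv ℝ (fun x => f (e.symm x)) x v) (f (e.symm x)) = 0 := by
    intro v
    have h1 : ∀ i, mink (pd i (fun x => f (e.symm x)) x) (f (e.symm x)) = 0 := by
      intro i
      have hsm := contDiffOn_comp_symm he hf.smooth
      have hd := diffAt_of_contDiffOn e.open_target hsm hx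
      have h := pd_congr (φ := fun x => mink (f (e.symm x)) (f (e.symm x))) (ψ := fun _ => -1)
        e.open_target (fun y _ => (hf.mem _).1) hx i
      rw [pd_mink hd hd, pd_const, mink_comm (f (e.symm x))] at h
      linarith
    rw [clm_plane_apply, mink_add_left, mink_smul_left, mink_smul_left]
    have h0 := h1 0
    have h1 := h1 1
    rw [pd] at h0 h1
    rw [h0, h1]; ring
  have hpos : ∀ v : Plane, v ≠ 0 → 0 < mink (fderiv ℝ (fun x => f (e.symm x)) x v)
      (fderiv ℝ (fun x => f (e.symm x)) x v) := fun v hv =>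
    mink_self_pos_of_orth (hf.mem (e.symm x)) (horth v) fun h =>
      hv (hinj (by rw [h, map_zero]))
  rw [Adapted.det_firstForm]
  simp only [pd]
  set α := fderiv ℝ (fun x => f (e.symm x)) x
  set g00 := mink (α (EuclideanSpace.single 0 1)) (α (EuclideanSpace.single 0 1)) with h00
  set g01 := mink (α (EuclideanSpace.single 0 1)) (α (EuclideanSpace.single 1 1)) with h01
  set g11 := mink (α (EuclideanSpace.single 1 1)) (α (EuclideanSpace.single 1 1)) with h11
  have p0 : 0 < g00 := hpos _ fun h => by
    have := congrArg (fun z : Plane => z 0) h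
    simp at this
  -- The second coordinate vector made orthogonal to the first; the square norm of its image is g₀₀
  -- times the determinant.
  have p1 := hpos (g00 • EuclideanSpace.single 1 1 - g01 • EuclideanSpace.single 0 1) fun h => by
    have := congrArg (fun z : Plane => z 1) h
    simp at this
    exact p0.ne' this
  have e1 : mink (α (g00 • EuclideanSpace.single 1 1 - g01 • EuclideanSpace.single 0 1))
      (α (g00 • EuclideanSpace.single 1 1 - g01 • EuclideanSpace.single 0 1))
      = g00 * (g00 * g11 - g01 * g01) := by
    rw [map_sub, map_smul, map_smul, sub_eq_add_neg, ← neg_smul]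
    simp only [mink_add_left, mink_add_right, mink_smul_left, mink_smul_right,
      mink_comm (α (EuclideanSpace.single 1 1)) (α (EuclideanSpace.single 0 1)), ← h00, ← h01,
      ← h11]
    ring
  rw [e1] at p1
  exact pos_of_mul_pos_right p1 p0.le

theorem IsSurface.adapted :
    Adapted e.target (-1) 1 (fun x => f (e.symm x)) (fun x => n (e.symm x)) where
  isOpen := e.open_target
  smooth := contDiffOn_comp_symm he hf.smooth
  smooth_normal := contDiffOn_comp_symm he hf.smooth_normal
  ne := by norm_num
  ne' := one_ne_zero
  norm x _ := (hf.mem _).1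
  norm' x _ := hf.unit _
  orth x _ := hf.tangent _
  tangent x hx i := by
    obtain ⟨b, _, hb⟩ := exists_fderiv_comp_symm he hx
    rw [pd, hb f hf.smooth]
    exact hf.mink_differential _ _
  det _ hx := (hf.det_firstForm_pos he hx).ne'

theorem IsSurface.detRatio_eq {x : Plane} (hx : x ∈ e.target) :
    detRatio (fun y => f (e.symm y)) (fun y => n (e.symm y)) x = surfaceRatio f n (e.symm x) := by
  obtain ⟨b, _, hb⟩ := exists_fderiv_comp_symm he hx
  have h1 : firstForm (fun y => f (e.symm y)) x
      = pairMatrix ((differential f (e.symm x)).comp b) ((differential f (e.symm x)).comp b) := by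
    rw [← hb f hf.smooth]; rfl
  have h2 : secondForm (fun y => f (e.symm y)) (fun y => n (e.symm y)) x
      = -pairMatrix ((differential f (e.symm x)).comp b) ((differential n (e.symm x)).comp b) := by
    rw [← hb f hf.smooth, ← hb n hf.smooth_normal]; rfl
  have hd := (hf.adapted he).det x hx
  have hneg : ∀ m : Matrix (Fin 2) (Fin 2) ℝ, (-m).det = m.det := fun m => by
    simp [Matrix.det_fin_two]
  rw [detRatio, surfaceRatio, h2, h1, hneg, hneg, det_pairMatrix_comp, det_pairMatrix_comp]
  rw [h1, det_pairMatrix_comp] at hd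
  exact mul_div_mul_left _ _ (left_ne_zero_of_mul hd)

omit he

theorem IsSurface.gaussCurvature_eq [IsManifold (𝓡 2) ∞ M] (p : M) :
    gaussCurvature f p = -1 + surfaceRatio f n p := by
  have he := IsManifold.chart_mem_maximalAtlas (I := 𝓡 2) (n := ∞) p
  have hx := (chartAt Plane p).map_source (mem_chart_source Plane p)
  have h := (hf.adapted he).curvature_eq hx rfl rfl
  have h2 := hf.detRatio_eq he hx
  rw [(chartAt Plane p).left_inv (mem_chart_source Plane p)] at h2
  rw [gaussCurvature, h, ← h2, detRatio]

include he

/-- By the Gauss equation K + 1 is det II / det I, and det I is positive. The sign of II itself is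
left open. -/
theorem IsSurface.definite [IsManifold (𝓡 2) ∞ M] (hK : ∀ p, -1 < gaussCurvature f p) :
    Definite e.target (-1) 1 (fun x => f (e.symm x)) (fun x => n (e.symm x)) where
  toAdapted := hf.adapted he
  det_pos x hx := by
    have h1 := hf.detRatio_eq he hx
    have h2 := hK (e.symm x)
    rw [hf.gaussCurvature_eq, ← h1] at h2
    have h3 : 0 < detRatio (fun y => f (e.symm y)) (fun y => n (e.symm y)) x := by linarith
    exact (div_pos_iff_of_pos_right (hf.det_firstForm_pos he hx)).1 h3

end Charts

/-! ### Isotropic fields and the Klotz differential. -/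

theorem pd_ofReal {φ : Plane → ℝ} {x : Plane} (hφ : DifferentiableAt ℝ φ x) (i : Fin 2) :
    pd i (fun y => ((φ y : ℝ) : ℂ)) x = ((pd i φ x : ℝ) : ℂ) :=
  pd_clm Complex.ofRealCLM hφ i

theorem diff_ofReal {φ : Plane → ℝ} {x : Plane} (hφ : DifferentiableAt ℝ φ x) :
    DifferentiableAt ℝ (fun y => (φ y : ℂ)) x :=
  Complex.ofRealCLM.differentiableAt.comp x hφ

/-- The derivative of the value of a form on a vector field. -/
theorem pd_cform {g : Plane → Matrix (Fin 2) (Fin 2) ℝ} {Y : Plane → Fin 2 → ℂ} {x : Plane}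
    (hg : ∀ i j, DifferentiableAt ℝ (fun y => g y i j) x)
    (hY : ∀ i, DifferentiableAt ℝ (fun y => Y y i) x) (m : Fin 2) :
    pd m (fun y => cform (g y) (Y y) (Y y)) x
      = ∑ i, ∑ j, ((((pd m (fun y => g y i j) x : ℝ) : ℂ) * Y x i + g x i j * pd m (fun y => Y y i) x)
          * Y x j + g x i j * Y x i * pd m (fun y => Y y j) x) := by
  have h1 : ∀ i j, DifferentiableAt ℝ (fun y => (g y i j : ℂ) * Y y i) x := fun i j =>
    (diff_ofReal (hg i j)).fun_mul (hY i)
  simp only [cform]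
  rw [pd_sum _ fun i _ => DifferentiableAt.fun_sum fun j _ => (h1 i j).fun_mul (hY j)]
  refine Finset.sum_congr rfl fun i _ => ?_
  rw [pd_sum _ fun j _ => (h1 i j).fun_mul (hY j)]
  refine Finset.sum_congr rfl fun j _ => ?_
  rw [pd_cmul (h1 i j) (hY j), pd_cmul (diff_ofReal (hg i j)) (hY i), pd_ofReal (hg i j)]

theorem cform_conjv (b : Matrix (Fin 2) (Fin 2) ℝ) (Y : Fin 2 → ℂ) :
    cform b (conjv Y) (conjv Y) = (starRingEnd ℂ) (cform b Y Y) := by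
  simp [cform, conjv, Fin.sum_univ_two]

/-- A definite form does not vanish on a nonzero vector and its conjugate. -/
theorem cform_conj_ne_zero {b : Matrix (Fin 2) (Fin 2) ℝ} (hs : b 1 0 = b 0 1) (hb : 0 < b.det)
    {Y : Fin 2 → ℂ} (hY : Y ≠ 0) : cform b Y (conjv Y) ≠ 0 := by
  intro h
  rw [Matrix.det_fin_two, hs] at hb
  have e : (b 0 0 : ℂ) * cform b Y (conjv Y)
      = ((Complex.normSq (b 0 0 * Y 0 + b 0 1 * Y 1)
        + (b 0 0 * b 1 1 - b 0 1 * b 0 1) * Complex.normSq (Y 1) : ℝ) : ℂ) := by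
    push_cast
    rw [← Complex.mul_conj, ← Complex.mul_conj]
    simp [cform, conjv, Fin.sum_univ_two, hs]
    ring
  rw [h, mul_zero] at e
  have e' := Complex.ofReal_eq_zero.1 e.symm
  have h1 := Complex.normSq_nonneg (b 0 0 * Y 0 + b 0 1 * Y 1)
  have h2 := mul_nonneg hb.le (Complex.normSq_nonneg (Y 1))
  have h3 : Complex.normSq (Y 1) = 0 := by
    have : (b 0 0 * b 1 1 - b 0 1 * b 0 1) * Complex.normSq (Y 1) = 0 := by linarith
    exact (mul_eq_zero.1 this).resolve_left hb.ne'
  have h4 : Complex.normSq (b 0 0 * Y 0 + b 0 1 * Y 1) = 0 := by linarith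
  have hY1 : Y 1 = 0 := Complex.normSq_eq_zero.1 h3
  have h5 := Complex.normSq_eq_zero.1 h4
  have hb0 : b 0 0 ≠ 0 := by
    intro h; rw [h] at hb; nlinarith [sq_nonneg (b 0 1)]
  rw [hY1, mul_zero, add_zero] at h5
  have hY0 : Y 0 = 0 := (mul_eq_zero.1 h5).resolve_left (by exact_mod_cast hb0)
  exact hY (by ext i; fin_cases i <;> simp [hY0, hY1])

/-- The inverse of a form in terms of isotropic vectors `Y` and `Z`. -/
theorem inverse_isotropic {h00 h01 h11 Y0 Y1 Z0 Z1 : ℂ}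
    (hY : h00 * Y0 * Y0 + 2 * h01 * Y0 * Y1 + h11 * Y1 * Y1 = 0)
    (hZ : h00 * Z0 * Z0 + 2 * h01 * Z0 * Z1 + h11 * Z1 * Z1 = 0)
    (hβ : h00 * Y0 * Z0 + h01 * (Y0 * Z1 + Y1 * Z0) + h11 * Y1 * Z1 ≠ 0) :
    let β := h00 * Y0 * Z0 + h01 * (Y0 * Z1 + Y1 * Z0) + h11 * Y1 * Z1
    let H := h00 * h11 - h01 * h01
    let W := Y0 * Z1 - Y1 * Z0
    β ^ 2 = -H * W ^ 2 ∧ W ≠ 0 ∧ h11 * β = 2 * H * (Y0 * Z0) ∧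
      -h01 * β = H * (Y0 * Z1 + Y1 * Z0) ∧ h00 * β = 2 * H * (Y1 * Z1) := by
  intro β H W
  have h1 : β ^ 2 = -H * W ^ 2 := by
    simp only [β, H, W]
    linear_combination (h00 * Z0 * Z0 + 2 * h01 * Z0 * Z1 + h11 * Z1 * Z1) * hY
  have hW : W ≠ 0 := by
    intro h
    rw [h] at h1
    exact hβ (pow_eq_zero_iff two_ne_zero |>.1 (h1.trans (by ring)))
  have hW2 : W ^ 2 ≠ 0 := pow_ne_zero 2 hW
  refine ⟨h1, hW, ?_, ?_, ?_⟩ <;> apply mul_left_cancel₀ hW2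
  · have e : h11 * W ^ 2 + 2 * β * (Y0 * Z0) = 0 := by
      simp only [β, W]; linear_combination Z0 ^ 2 * hY + Y0 ^ 2 * hZ
    linear_combination β * e - 2 * Y0 * Z0 * h1
  · have e : -h01 * W ^ 2 + β * (Y0 * Z1 + Y1 * Z0) = 0 := by
      simp only [β, W]; linear_combination Z0 * Z1 * hY + Y0 * Y1 * hZ
    linear_combination β * e - (Y0 * Z1 + Y1 * Z0) * h1
  · have e : h00 * W ^ 2 + 2 * β * (Y1 * Z1) = 0 := by
      simp only [β, W]; linear_combination Z1 ^ 2 * hY + Y1 ^ 2 * hZ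
    linear_combination β * e - 2 * Y1 * Z1 * h1

namespace Definite

variable {U : Set Plane} {ε δ : ℝ} {f n : Plane → E13} (A : Definite U ε δ f n)

include A

/-- The inverse density of the second fundamental form in terms of an isotropic field. -/
theorem dens_isotropic {x : Plane} (hx : x ∈ U) {Y : Fin 2 → ℂ} (hY : Y ≠ 0)
    (hiso : cform (secondForm f n x) Y Y = 0) :
    let W := Y 0 * conjv Y 1 - Y 1 * conjv Y 0
    let s := (Real.sqrt (secondForm f n x).det : ℂ) * W / cform (secondForm f n x) Y (conjv Y)
    W ≠ 0 ∧ s ^ 2 = -1 ∧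
      ∀ i j, (dens f n x i j : ℂ) * W = s * (Y i * conjv Y j + conjv Y i * Y j) := by
  intro W s
  have hsym := A.secondForm_symm hx 1 0
  have hβ := cform_conj_ne_zero hsym (A.det_pos x hx) hY
  have hisoc : cform (secondForm f n x) (conjv Y) (conjv Y) = 0 := by
    rw [cform_conjv, hiso, map_zero]
  have hr : (Real.sqrt (secondForm f n x).det : ℂ) ≠ 0 := by
    exact_mod_cast (Real.sqrt_pos.2 (A.det_pos x hx)).ne'
  have hr2 : (Real.sqrt (secondForm f n x).det : ℂ) ^ 2
      = (secondForm f n x 0 0 : ℂ) * secondForm f n x 1 1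
        - secondForm f n x 0 1 * secondForm f n x 0 1 := by
    have := Real.sq_sqrt (A.det_pos x hx).le
    rw [A.det_secondForm hx] at this ⊢
    exact_mod_cast this
  have eβ : cform (secondForm f n x) Y (conjv Y) = secondForm f n x 0 0 * Y 0 * conjv Y 0
      + secondForm f n x 0 1 * (Y 0 * conjv Y 1 + Y 1 * conjv Y 0)
      + secondForm f n x 1 1 * Y 1 * conjv Y 1 := by
    simp only [cform, Fin.sum_univ_two, hsym]; ring
  have eY : ∀ Y : Fin 2 → ℂ, cform (secondForm f n x) Y Y = secondForm f n x 0 0 * Y 0 * Y 0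
      + 2 * secondForm f n x 0 1 * Y 0 * Y 1 + secondForm f n x 1 1 * Y 1 * Y 1 := fun Y => by
    simp only [cform, Fin.sum_univ_two, hsym]; ring
  rw [eY] at hiso hisoc
  rw [eβ] at hβ
  obtain ⟨h1, hW, h00, h01, h11⟩ := inverse_isotropic hiso hisoc hβ
  rw [← hr2] at h1 h00 h01 h11
  rw [← eβ] at h1 h00 h01 h11 hβ
  have hd := A.dens_apply x hx
  refine ⟨hW, ?_, fun i j => ?_⟩
  · simp only [s]
    field_simp
    linear_combination h1
  · rw [hd]
    simp only [s, W]
    fin_cases i <;> fin_cases j <;> simp <;> field_simp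
    · linear_combination h00
    · linear_combination h01
    · linear_combination h01
    · linear_combination h11

/-- The Cauchy-Riemann derivative of the Klotz differential in terms of the tangential part of the
Laplacian of `f` with respect to the second fundamental form. -/
theorem dbar_eq {S : Set Plane} (hS : IsOpen S) (hSU : S ⊆ U) {Y : Plane → Fin 2 → ℂ}
    (hY : ContDiffOn ℝ ∞ Y S)
    (hiso : ∀ x ∈ S, Y x ≠ 0 ∧ cform (secondForm f n x) (Y x) (Y x) = 0) {x : Plane} (hx : x ∈ S) :
    ∃ c : ℂ, c ≠ 0 ∧ dbar (firstForm f) (secondForm f n) Y x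
      = c * ∑ k, Y x k * (mink (divGrad (dens f n) f x) (pd k f x) : ℝ) := by
  have hxU := hSU hx
  set Z : Plane → Fin 2 → ℂ := fun y => conjv (Y y) with hZ
  set W : Plane → ℂ := fun y => Y y 0 * Z y 1 - Y y 1 * Z y 0 with hW
  set β : Plane → ℂ := fun y => cform (secondForm f n y) (Y y) (Z y) with hβ
  set s : Plane → ℂ := fun y => (Real.sqrt (secondForm f n y).det : ℂ) * W y / β y with hs
  have hall : ∀ y ∈ S, W y ≠ 0 ∧ s y ^ 2 = -1 ∧
      ∀ i j, (dens f n y i j : ℂ) * W y = s y * (Y y i * Z y j + Z y i * Y y j) := fun y hy =>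
    A.dens_isotropic (hSU hy) (hiso y hy).1 (hiso y hy).2
  have hβ0 : ∀ y ∈ S, β y ≠ 0 := fun y hy =>
    cform_conj_ne_zero (A.secondForm_symm (hSU hy) 1 0) (A.det_pos y (hSU hy)) (hiso y hy).1
  have dY : ∀ i, DifferentiableAt ℝ (fun y => Y y i) x := fun i =>
    diffAt_of_contDiffOn hS (contDiffOn_pi.1 hY i) hx
  have dZ : ∀ i, DifferentiableAt ℝ (fun y => Z y i) x := fun i =>
    Complex.conjCLE.differentiableAt.comp x (dY i)
  have dg : ∀ i j, DifferentiableAt ℝ (fun y => firstForm f y i j) x := fun i j =>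
    diffAt_of_contDiffOn A.isOpen (A.smooth_firstForm i j) hxU
  have dh : ∀ i j, DifferentiableAt ℝ (fun y => secondForm f n y i j) x := fun i j =>
    diffAt_of_contDiffOn A.isOpen (A.smooth_secondForm i j) hxU
  have dP : ∀ i j, DifferentiableAt ℝ (fun y => dens f n y i j) x := fun i j =>
    diffAt_of_contDiffOn A.isOpen (A.smooth_dens i j) hxU
  have dW : DifferentiableAt ℝ W x := ((dY 0).fun_mul (dZ 1)).fun_sub ((dY 1).fun_mul (dZ 0))
  have dβ : DifferentiableAt ℝ β x := DifferentiableAt.fun_sum fun i _ =>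
    DifferentiableAt.fun_sum fun j _ => ((diff_ofReal (dh i j)).fun_mul (dY i)).fun_mul (dZ j)
  have dr : DifferentiableAt ℝ (fun y => Real.sqrt (secondForm f n y).det) x :=
    (diffAt_of_contDiffOn A.isOpen A.smooth_det_secondForm hxU).sqrt (A.det_pos x hxU).ne'
  have ds : DifferentiableAt ℝ s x := by
    simp only [hs, div_eq_mul_inv]
    exact ((diff_ofReal dr).fun_mul dW).fun_mul (dβ.fun_inv (hβ0 x hx))
  obtain ⟨hWx, hsx, hPx⟩ := hall x hx
  have hs0 : s x ≠ 0 := by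
    intro h; rw [h] at hsx; norm_num at hsx
  -- As s² = -1 throughout `S`, the function `s` is a square root of -1 with zero derivative; its
  -- sign depends on the orientation of `Y` and the sign of II.
  have es : ∀ m, pd m s x = 0 := by
    intro m
    have h := pd_congr hS (φ := fun y => s y * s y) (ψ := fun _ => (-1 : ℂ))
      (fun y hy => by rw [← sq]; exact (hall y hy).2.1) hx m
    rw [pd_cmul ds ds, pd_const] at h
    have : s x * pd m s x = 0 := by linear_combination h / 2
    exact (mul_eq_zero.1 this).resolve_left hs0
  have eW : ∀ m, pd m W x = pd m (fun y => Y y 0) x * Z x 1 + Y x 0 * pd m (fun y => Z y 1) x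
      - (pd m (fun y => Y y 1) x * Z x 0 + Y x 1 * pd m (fun y => Z y 0) x) := by
    intro m
    rw [hW, pd_sub ((dY 0).fun_mul (dZ 1)) ((dY 1).fun_mul (dZ 0)), pd_cmul (dY 0) (dZ 1),
      pd_cmul (dY 1) (dZ 0)]
  have eP : ∀ m i j, ((pd m (fun y => dens f n y i j) x : ℝ) : ℂ) * W x
        + (dens f n x i j : ℂ) * pd m W x
      = s x * (pd m (fun y => Y y i) x * Z x j + Y x i * pd m (fun y => Z y j) x
        + (pd m (fun y => Z y i) x * Y x j + Z x i * pd m (fun y => Y y j) x)) := by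
    intro m i j
    have h := pd_congr hS (fun y hy => (hall y hy).2.2 i j) hx m
    rw [pd_cmul (diff_ofReal (dP i j)) dW, pd_ofReal (dP i j),
      pd_cmul ds (((dY i).fun_mul (dZ j)).fun_add ((dZ i).fun_mul (dY j))), es, zero_mul, zero_add,
      pd_add ((dY i).fun_mul (dZ j)) ((dZ i).fun_mul (dY j)), pd_cmul (dY i) (dZ j),
      pd_cmul (dZ i) (dY j)] at h
    exact h
  -- Since `Z` is isotropic, the quotient is the `Y`-coefficient of the bracket in the basis `Y`,
  -- `Z`, which Cramer's rule gives without II.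
  have hα : cform (secondForm f n x) (bracket Z Y x) (Z x) / β x
      = (bracket Z Y x 0 * Z x 1 - bracket Z Y x 1 * Z x 0) / W x := by
    rw [div_eq_div_iff (hβ0 x hx) hWx]
    have hisoc : cform (secondForm f n x) (Z x) (Z x) = 0 := by
      rw [hZ, cform_conjv, (hiso x hx).2, map_zero]
    simp only [hβ, hW, cform, Fin.sum_univ_two, A.secondForm_symm hxU 1 0] at hisoc ⊢
    linear_combination (bracket Z Y x 1 * Y x 0 - bracket Z Y x 0 * Y x 1) * hisoc
  refine ⟨W x / s x, div_ne_zero hWx hs0, ?_⟩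
  have e1 : dbar (firstForm f) (secondForm f n) Y x
      = cderiv (Z x) (fun y => cform (firstForm f y) (Y y) (Y y)) x
        - 2 * cform (firstForm f x) ((cform (secondForm f n x) (bracket Z Y x) (Z x) / β x) • Y x)
          (Y x) := rfl
  rw [e1, hα]
  simp only [cderiv, pd_cform dg dY]
  simp only [A.mink_divGrad hxU, A.pd_firstForm hxU, bracket, cderiv, cform,
    Fin.sum_univ_two, Pi.smul_apply, smul_eq_mul, A.dens_symm x hxU, A.pd_pd_comm hxU 1 0]
  push_cast
  -- Once `dens` and its derivatives are written in terms of `Y`, `Z` and the constant `s`, the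
  -- claim is an algebraic identity; Codazzi plays no role in it.
  have hP' : ∀ i j, (dens f n x i j : ℂ) = s x * (Y x i * Z x j + Z x i * Y x j) / W x :=
    fun i j => by rw [eq_div_iff hWx, hPx]
  have eP' : ∀ m i j, ((pd m (fun y => dens f n y i j) x : ℝ) : ℂ)
      = (s x * (pd m (fun y => Y y i) x * Z x j + Y x i * pd m (fun y => Z y j) x
        + (pd m (fun y => Z y i) x * Y x j + Z x i * pd m (fun y => Y y j) x))
        - s x * (Y x i * Z x j + Z x i * Y x j) / W x * pd m W x) / W x :=
    fun m i j => by rw [eq_div_iff hWx, ← hP', ← eP]; ring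
  simp only [hP', eP', eW]
  have f0 : ∀ j k, mink (pd j f x) (pd k f x) = firstForm f x j k := fun j k => rfl
  simp only [f0, Adapted.firstForm_symm]
  have hWv : W x = Y x 0 * Z x 1 - Y x 1 * Z x 0 := rfl
  generalize s x = σ at *
  generalize W x = w at *
  field_simp
  rw [hWv]
  ring

theorem dbar_eq_zero {S : Set Plane} (hS : IsOpen S) (hSU : S ⊆ U) {Y : Plane → Fin 2 → ℂ}
    (hY : ContDiffOn ℝ ∞ Y S)
    (hiso : ∀ x ∈ S, Y x ≠ 0 ∧ cform (secondForm f n x) (Y x) (Y x) = 0) {x : Plane} (hx : x ∈ S)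
    (h : ∀ k, mink (divGrad (dens f n) f x) (pd k f x) = 0) :
    dbar (firstForm f) (secondForm f n) Y x = 0 := by
  obtain ⟨c, _, hc⟩ := A.dbar_eq hS hSU hY hiso hx
  rw [hc]; simp [h]

/-- An isotropic field for the second fundamental form. -/
noncomputable def _root_.HypSurf.isotropicField (f n : Plane → E13) (x : Plane) : Fin 2 → ℂ :=
  ![-(secondForm f n x 0 1 : ℂ) + Complex.I * Real.sqrt (secondForm f n x).det,
    (secondForm f n x 0 0 : ℂ)]

theorem smooth_isotropicField : ContDiffOn ℝ ∞ (isotropicField f n) U := by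
  have hc : ∀ {φ : Plane → ℝ}, ContDiffOn ℝ ∞ φ U → ContDiffOn ℝ ∞ (fun y => (φ y : ℂ)) U :=
    fun h => Complex.ofRealCLM.contDiff.comp_contDiffOn h
  have hs : ContDiffOn ℝ ∞ (fun y => Real.sqrt (secondForm f n y).det) U :=
    A.smooth_det_secondForm.sqrt fun y hy => (A.det_pos y hy).ne'
  rw [contDiffOn_pi]
  intro i
  fin_cases i
  · exact (hc (A.smooth_secondForm 0 1)).neg.add (contDiffOn_const.mul (hc hs))
  · exact hc (A.smooth_secondForm 0 0)

theorem secondForm_zero_ne {x : Plane} (hx : x ∈ U) : secondForm f n x 0 0 ≠ 0 := by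
  intro h
  have h1 := A.det_pos x hx
  rw [A.det_secondForm hx, h] at h1
  nlinarith [sq_nonneg (secondForm f n x 0 1)]

theorem isotropicField_isotropic {x : Plane} (hx : x ∈ U) : isotropicField f n x ≠ 0 ∧
    cform (secondForm f n x) (isotropicField f n x) (isotropicField f n x) = 0 := by
  constructor
  · intro h
    have h1 := congrFun h 1
    simp only [isotropicField, Matrix.cons_val_one, Matrix.cons_val_fin_one, Pi.zero_apply] at h1
    exact A.secondForm_zero_ne hx (by exact_mod_cast h1)
  · have h2 : (Real.sqrt (secondForm f n x).det : ℂ) ^ 2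
        = (secondForm f n x 0 0 : ℂ) * secondForm f n x 1 1
          - secondForm f n x 0 1 * secondForm f n x 0 1 := by
      have := Real.sq_sqrt (A.det_pos x hx).le
      rw [A.det_secondForm hx] at this ⊢
      exact_mod_cast this
    simp only [cform, isotropicField, Fin.sum_univ_two, Matrix.cons_val_zero, Matrix.cons_val_one,
      Matrix.cons_val_fin_one, A.secondForm_symm hx 1 0]
    linear_combination (secondForm f n x 0 0 : ℂ) * Real.sqrt (secondForm f n x).det ^ 2
      * Complex.I_sq - (secondForm f n x 0 0 : ℂ) * h2

theorem tangent_eq_zero_of_dbar {x : Plane} (hx : x ∈ U)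
    (h : dbar (firstForm f) (secondForm f n) (isotropicField f n) x = 0) (k : Fin 2) :
    mink (divGrad (dens f n) f x) (pd k f x) = 0 := by
  obtain ⟨c, hc0, hc⟩ := A.dbar_eq A.isOpen subset_rfl A.smooth_isotropicField
    (fun y hy => A.isotropicField_isotropic hy) hx
  rw [hc] at h
  have h1 := (mul_eq_zero.1 h).resolve_left hc0
  simp only [isotropicField, Fin.sum_univ_two, Matrix.cons_val_zero, Matrix.cons_val_one,
    Matrix.cons_val_fin_one] at h1
  -- The two tangential components are real: the imaginary part is √(det II) times the first, and
  -- the real part then gives II₀₀ times the second.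
  have hre := congrArg Complex.re h1
  have him := congrArg Complex.im h1
  simp at hre him
  have hr := (Real.sqrt_pos.2 (A.det_pos x hx)).ne'
  have t0 : mink (divGrad (dens f n) f x) (pd 0 f x) = 0 := by
    rcases him with h | h
    · exact absurd h hr
    · exact h
  rw [t0] at hre
  have t1 : mink (divGrad (dens f n) f x) (pd 1 f x) = 0 := by
    simpa [A.secondForm_zero_ne hx] using hre
  fin_cases k
  exacts [t0, t1]

end Definite

/-! ### The four equivalences with stationarity of the determinant ratio. -/

section Main

variable {M : Type*} [TopologicalSpace M] [ChartedSpace Plane M] [IsManifold (𝓡 2) ∞ M]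
  {f n : M → E13} (hf : IsSurface f n) (hK : ∀ p, -1 < gaussCurvature f p)

/-- The quotient of the determinants of the fundamental forms is stationary in all charts. -/
def IsStationary (f n : M → E13) : Prop :=
  ∀ e ∈ IsManifold.maximalAtlas (𝓡 2) ∞ M, ∀ x ∈ e.target, ∀ l,
    pd l (detRatio (fun y => f (e.symm y)) (fun y => n (e.symm y))) x = 0

include hf

theorem IsSurface.isStationary_of_const {c : ℝ} (hc : ∀ p, gaussCurvature f p = c) :
    IsStationary f n := by
  intro e he x hx l
  have h : ∀ y ∈ e.target, detRatio (fun y => f (e.symm y)) (fun y => n (e.symm y)) y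
      = c + 1 := by
    intro y hy
    have h1 := hf.gaussCurvature_eq (e.symm y)
    rw [hc, ← hf.detRatio_eq he hy] at h1
    linarith
  rw [pd_congr e.open_target h hx, pd_const]

omit [IsManifold (𝓡 2) ∞ M] in
theorem IsSurface.contMDiff_legendrian :
    ContMDiff (𝓡 2) 𝓘(ℝ, E13 × E13) ∞ (legendrianGaussMap f n) :=
  hf.smooth.prodMk_space hf.smooth_normal

omit [IsManifold (𝓡 2) ∞ M] in
theorem IsSurface.contMDiff_lagrangian :
    ContMDiff (𝓡 2) 𝓘(ℝ, Bivector) ∞ (lagrangianGaussMap f n) := by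
  have h : ContDiff ℝ ∞ fun p : E13 × E13 => wedge p.1 p.2 :=
    (wedgeL.contDiff.comp contDiff_fst).clm_apply contDiff_snd
  exact h.contMDiff.comp hf.contMDiff_legendrian

omit [IsManifold (𝓡 2) ∞ M] in
theorem IsSurface.legendrian_mem (p : M) : legendrianGaussMap f n p ∈ UH3 :=
  ⟨hf.mem p, hf.unit p, hf.tangent p⟩

include hK

/-- On a ball in a chart the differential of D vanishes, so the chart-independent `surfaceRatio` is
locally constant, hence constant by connectedness. -/
theorem IsSurface.curvature_const_of_isStationary [PreconnectedSpace M] [Nonempty M]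
    (h : IsStationary f n) : ∃ c : ℝ, ∀ p, gaussCurvature f p = c := by
  have hloc : IsLocallyConstant (surfaceRatio f n) := by
    rw [IsLocallyConstant.iff_eventually_eq]
    intro p
    set e := chartAt Plane p with hedef
    have he : e ∈ IsManifold.maximalAtlas (𝓡 2) ∞ M := IsManifold.chart_mem_maximalAtlas p
    have hp : p ∈ e.source := mem_chart_source Plane p
    have hx : e p ∈ e.target := e.map_source hp
    obtain ⟨r, hr, hball⟩ := Metric.isOpen_iff.1 e.open_target _ hx
    set D := detRatio (fun y => f (e.symm y)) (fun y => n (e.symm y)) with hD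
    have hsm : ContDiffOn ℝ ∞ D e.target := (hf.definite he hK).smooth_detRatio
    have hconst : ∀ y ∈ Metric.ball (e p) r, D y = D (e p) := by
      intro y hy
      refine Metric.isOpen_ball.is_const_of_fderiv_eq_zero (𝕜 := ℝ) (convex_ball _ _).isPreconnected
        ((hsm.differentiableOn (by simp)).mono hball) (fun z hz => ?_) hy (Metric.mem_ball_self hr)
      ext v
      have hv : v = v 0 • EuclideanSpace.single 0 1 + v 1 • EuclideanSpace.single 1 1 := by
        ext i; fin_cases i <;> simp
      have h0 := h e he z (hball hz) 0
      have h1 := h e he z (hball hz) 1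
      rw [pd] at h0 h1
      rw [hv, map_add, map_smul, map_smul, hD, h0, h1]
      simp
    have hnhds : e.source ∩ e ⁻¹' Metric.ball (e p) r ∈ nhds p :=
      Filter.inter_mem (e.open_source.mem_nhds hp)
        ((e.continuousAt hp).preimage_mem_nhds (Metric.ball_mem_nhds _ hr))
    filter_upwards [hnhds] with q hq
    have h2 := hconst (e q) hq.2
    rw [hD, hf.detRatio_eq he (hball hq.2), hf.detRatio_eq he hx, e.left_inv hq.1,
      e.left_inv hp] at h2
    exact h2
  obtain ⟨p₀⟩ := ‹Nonempty M›
  refine ⟨-1 + surfaceRatio f n p₀, fun p => ?_⟩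
  rw [hf.gaussCurvature_eq, hloc.apply_eq_of_preconnectedSpace p p₀]

/-- The chart clause of `IsHarmonic` is definitionally `IsCritical` on the target of the chart, so
the local criteria apply directly. -/
theorem IsSurface.isHarmonic_legendrian_iff :
    IsHarmonic (secondFormIn f n) UH3 unitMetric (legendrianGaussMap f n) ↔ IsStationary f n := by
  constructor
  · intro h e he x hx
    have A := hf.definite he hK
    exact A.pd_detRatio_eq_zero hx
      (A.tangent_eq_zero_of_legendrian (fun x _ => hf.mem _) (h.2.2 e he) hx)
  · intro h
    exact ⟨hf.contMDiff_legendrian, hf.legendrian_mem,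
      fun e he => (hf.definite he hK).isCritical_legendrian (h e he)⟩

theorem IsSurface.isHarmonic_lagrangian_iff :
    IsHarmonic (secondFormIn f n) Geo geoMetric (lagrangianGaussMap f n) ↔ IsStationary f n := by
  constructor
  · intro h e he x hx
    have A := hf.definite he hK
    exact A.pd_detRatio_eq_zero hx
      (A.tangent_eq_zero_of_lagrangian (fun x _ => hf.mem _) (h.2.2 e he) hx)
  · intro h
    exact ⟨hf.contMDiff_lagrangian, fun p => ⟨_, hf.legendrian_mem p, rfl⟩,
      fun e he => (hf.definite he hK).isCritical_lagrangian (h e he)⟩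

theorem IsSurface.klotzHolomorphic_iff : KlotzHolomorphic f n ↔ IsStationary f n := by
  constructor
  · intro h e he x hx
    have A := hf.definite he hK
    refine A.pd_detRatio_eq_zero hx (A.tangent_eq_zero_of_dbar hx ?_)
    -- A single isotropic field, defined on the whole chart, already forces stationarity.
    exact h e he e.target e.open_target subset_rfl _ A.smooth_isotropicField
      (fun y hy => A.isotropicField_isotropic hy) x hx
  · intro h e he S hS hSU Y hY hiso x hx
    have A := hf.definite he hK
    exact A.dbar_eq_zero hS hSU hY hiso hx
      (A.tangent_divGrad_eq_zero (hSU hx) (h e he x (hSU hx)))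

end Main

end HypSurf

theorem theoremA {M : Type*} [TopologicalSpace M] [T2Space M] [ConnectedSpace M]
    [ChartedSpace HypSurf.Plane M] [IsManifold (𝓡 2) ∞ M]
    (f n : M → HypSurf.E13) (hf : HypSurf.IsSurface f n)
    (hK : ∀ p, -1 < HypSurf.gaussCurvature f p) :
    List.TFAE
      [∃ c : ℝ, ∀ p, HypSurf.gaussCurvature f p = c,
       HypSurf.IsHarmonic (HypSurf.secondFormIn f n) HypSurf.UH3 HypSurf.unitMetric
         (HypSurf.legendrianGaussMap f n),
       HypSurf.IsHarmonic (HypSurf.secondFormIn f n) HypSurf.Geo HypSurf.geoMetric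
         (HypSurf.lagrangianGaussMap f n),
       HypSurf.KlotzHolomorphic f n] := by
  have h : (∃ c : ℝ, ∀ p, HypSurf.gaussCurvature f p = c) ↔ HypSurf.IsStationary f n :=
    ⟨fun ⟨_, hc⟩ => hf.isStationary_of_const hc, hf.curvature_const_of_isStationary hK⟩
  refine List.tfae_of_forall (HypSurf.IsStationary f n) _ ?_
  simp [h, hf.isHarmonic_legendrian_iff hK, hf.isHarmonic_lagrangian_iff hK,
    hf.klotzHolomorphic_iff hK]
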